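/- Let $n\ge 1$ and let $\mathfrak T_n$ be the full transformation monoid, that is, the monoid of all self-maps of $[n]=\{1,\dots,n\}$ under composition. For $1\le k\le n$ let $e_k\in\mathfrak T_n$ be the idempotent with $e_k(i)=i$ for $i\le k$ and $e_k(i)=1$ for $i>k$, let $G_{e_k}$ be the group of units of the monoid $e_k\mathfrak T_ne_k$, identified with the symmetric group $\mathfrak S_k$ by $g\mapsto g|_{[k]}$, and let $L_{e_k}=\{f\in\mathfrak T_n\mid \mathfrak T_nf=\mathfrak T_ne_k\}$. The space $\mathbb CL_{e_k}$ is a $\mathbb C\mathfrak T_n$-$\mathbb CG_{e_k}$-bimodule, where $G_{e_k}$ acts on the right by multiplication and $m\in\mathfrak T_n$ sends $\ell\in L_{e_k}$ to $m\ell$ if $m\ell\in L_{e_k}$ and to $0$ otherwise. For a partition $\lambda$ of $k$ let $S(\lambda)$ be the Specht module of $\mathbb C\mathfrak S_k$ (so $S((k))$ is the trivial and $S((1^k))$ the sign module), let $I(\lambda)=\mathbb CL_{e_k}\otimes_{\mathbb CG_{e_k}}S(\lambda)$, and let \[L(\lambda)=I(\lambda)\big/\{w\in I(\lambda)\mid e_k\,\mathbb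 C\mathfrak T_n\,w=0\},\] which is the simple $\mathbb C\mathfrak T_n$-module corresponding to $\lambda$. Here $(1^k)$ denotes the partition of $k$ with $k$ parts equal to $1$. Then for all $1\le k,r\le n$, all partitions $\lambda$ of $k$ and all $m\ge 0$, there is an isomorphism of complex vector spaces \[\operatorname{Ext}^m_{\mathbb C\mathfrak T_n}\bigl(L((1^r)),L(\lambda)\bigr)\cong\begin{cases}\mathbb C, & \text{if } \lambda=(1^{r+m}),\\ 0, & \text{otherwise.}\end{cases}\] -/

import Mathlib

open scoped TensorProduct

noncomputable section

/-! ### Maximal subgroups and Schützenberger representations of a monoid -/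

/-- For an idempotent `e` of a monoid `M`, the monoid `eMe`, with identity `e`. -/
def LocalMonoid {M : Type} [Monoid M] {e : M} (_he : IsIdempotentElem e) : Type :=
  Subsemigroup.corner e

instance LocalMonoid.instMonoid {M : Type} [Monoid M] {e : M} (he : IsIdempotentElem e) :
    Monoid (LocalMonoid he) where
  __ : Semigroup (LocalMonoid he) := inferInstanceAs (Semigroup (Subsemigroup.corner e))
  one := ⟨e, e, by simp only [he.eq]⟩
  one_mul x := Subtype.ext ((Subsemigroup.mem_corner_iff he).mp x.2).1
  mul_one x := Subtype.ext ((Subsemigroup.mem_corner_iff he).mp x.2).2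

/-- The underlying element of `M` of an element of `eMe`. -/
def LocalMonoid.val {M : Type} [Monoid M] {e : M} {he : IsIdempotentElem e}
    (x : LocalMonoid he) : M := Subtype.val x

theorem LocalMonoid.val_mul {M : Type} [Monoid M] {e : M} {he : IsIdempotentElem e}
    (x y : LocalMonoid he) : (x * y).val = x.val * y.val := rfl

theorem LocalMonoid.val_one {M : Type} [Monoid M] {e : M} {he : IsIdempotentElem e} :
    (1 : LocalMonoid he).val = e := rfl

theorem LocalMonoid.left_id {M : Type} [Monoid M] {e : M} {he : IsIdempotentElem e}
    (x : LocalMonoid he) : e * x.val = x.val := ((Subsemigroup.mem_corner_iff he).mp x.2).1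

theorem LocalMonoid.right_id {M : Type} [Monoid M] {e : M} {he : IsIdempotentElem e}
    (x : LocalMonoid he) : x.val * e = x.val := ((Subsemigroup.mem_corner_iff he).mp x.2).2

/-- The maximal subgroup `G_e` of `M` at the idempotent `e`: the group of units of `eMe`. -/
abbrev MaximalSubgroup {M : Type} [Monoid M] {e : M} (he : IsIdempotentElem e) : Type :=
  (LocalMonoid he)ˣ

/-- The `𝓛`-class `L_e = {m | Mm = Me}` of `e`. -/
def LClass {M : Type} [Monoid M] (e : M) : Set M :=
  {m | Set.range (fun a : M => a * m) = Set.range (fun a : M => a * e)}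

theorem mem_LClass_iff {M : Type} [Monoid M] {e m : M} :
    m ∈ LClass e ↔ (∃ a, a * m = e) ∧ ∃ b, b * e = m := by
  constructor
  · intro h
    have h' : Set.range (fun a : M => a * m) = Set.range (fun a : M => a * e) := h
    constructor
    · have : e ∈ Set.range (fun a : M => a * e) := ⟨1, one_mul e⟩
      rw [← h'] at this
      exact this
    · have : m ∈ Set.range (fun a : M => a * m) := ⟨1, one_mul m⟩
      rw [h'] at this
      exact this
  · rintro ⟨⟨a, ha⟩, ⟨b, hb⟩⟩
    apply Set.Subset.antisymm
    · rintro _ ⟨c, rfl⟩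
      exact ⟨c * b, by simp only [mul_assoc, hb]⟩
    · rintro _ ⟨c, rfl⟩
      exact ⟨c * a, by simp only [mul_assoc, ha]⟩

theorem LClass.mem_of_mul_mem {M : Type} [Monoid M] {e a b m : M} (hm : m ∈ LClass e)
    (h : a * (b * m) ∈ LClass e) : b * m ∈ LClass e := by
  obtain ⟨-, y, hy⟩ := mem_LClass_iff.mp hm
  obtain ⟨⟨x, hx⟩, -⟩ := mem_LClass_iff.mp h
  exact mem_LClass_iff.mpr ⟨⟨x * a, by rw [mul_assoc, hx]⟩, ⟨b * y, by rw [mul_assoc, hy]⟩⟩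

/-- The vector space `𝕜L_e` with basis `L_e`. -/
def SchutzenbergerSpace (𝕜 : Type) [Field 𝕜] {M : Type} [Monoid M] (e : M) : Type :=
  LClass e →₀ 𝕜

instance SchutzenbergerSpace.instAddCommGroup (𝕜 : Type) [Field 𝕜] {M : Type} [Monoid M] (e : M) :
    AddCommGroup (SchutzenbergerSpace 𝕜 e) := inferInstanceAs (AddCommGroup (LClass e →₀ 𝕜))

instance SchutzenbergerSpace.instModule (𝕜 : Type) [Field 𝕜] {M : Type} [Monoid M] (e : M) :
    Module 𝕜 (SchutzenbergerSpace 𝕜 e) := inferInstanceAs (Module 𝕜 (LClass e →₀ 𝕜))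

/-- The basis `L_e` of `𝕜L_e`. -/
def SchutzenbergerSpace.basis (𝕜 : Type) [Field 𝕜] {M : Type} [Monoid M] (e : M) :
    Module.Basis (LClass e) 𝕜 (SchutzenbergerSpace 𝕜 e) :=
  Module.Basis.ofRepr (LinearEquiv.refl 𝕜 (LClass e →₀ 𝕜))

open Classical in
/-- The action of `m : M` on `𝕜L_e`: for `ℓ` in `L_e`, `m ⊙ ℓ = mℓ` if `mℓ` is in `L_e`, and
`m ⊙ ℓ = 0` otherwise. -/
def schutzenbergerMap (𝕜 : Type) [Field 𝕜] {M : Type} [Monoid M] (e : M) (m : M) :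
    SchutzenbergerSpace 𝕜 e →ₗ[𝕜] SchutzenbergerSpace 𝕜 e :=
  (SchutzenbergerSpace.basis 𝕜 e).constr 𝕜 fun l : LClass e =>
    if h : m * (l : M) ∈ LClass e then SchutzenbergerSpace.basis 𝕜 e ⟨m * l, h⟩ else 0

theorem schutzenbergerMap_basis_of_mem (𝕜 : Type) [Field 𝕜] {M : Type} [Monoid M] (e : M) (m : M)
    (l : LClass e) (h : m * (l : M) ∈ LClass e) :
    schutzenbergerMap 𝕜 e m (SchutzenbergerSpace.basis 𝕜 e l) =
      SchutzenbergerSpace.basis 𝕜 e ⟨m * l, h⟩ := by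
  rw [schutzenbergerMap, Module.Basis.constr_basis, dif_pos h]

theorem schutzenbergerMap_basis_of_notMem (𝕜 : Type) [Field 𝕜] {M : Type} [Monoid M] (e : M)
    (m : M) (l : LClass e) (h : m * (l : M) ∉ LClass e) :
    schutzenbergerMap 𝕜 e m (SchutzenbergerSpace.basis 𝕜 e l) = 0 := by
  rw [schutzenbergerMap, Module.Basis.constr_basis, dif_neg h]

/-- The left Schützenberger representation `𝕜L_e` of `M`. -/
def schutzenberger (𝕜 : Type) [Field 𝕜] {M : Type} [Monoid M] (e : M) :
    Representation 𝕜 M (SchutzenbergerSpace 𝕜 e) where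
  toFun m := schutzenbergerMap 𝕜 e m
  map_one' := by
    refine (SchutzenbergerSpace.basis 𝕜 e).ext fun l => ?_
    have h : (1 : M) * (l : M) ∈ LClass e := by rw [one_mul]; exact l.2
    rw [schutzenbergerMap_basis_of_mem 𝕜 e 1 l h]
    exact congrArg _ (Subtype.ext (one_mul _))
  map_mul' a b := by
    refine (SchutzenbergerSpace.basis 𝕜 e).ext fun l => ?_
    rw [Module.End.mul_apply]
    by_cases hb : b * (l : M) ∈ LClass e
    · rw [schutzenbergerMap_basis_of_mem 𝕜 e b l hb]
      by_cases hab : a * (b * (l : M)) ∈ LClass e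
      · rw [schutzenbergerMap_basis_of_mem 𝕜 e a ⟨b * l, hb⟩ hab,
          schutzenbergerMap_basis_of_mem 𝕜 e (a * b) l (by rw [mul_assoc]; exact hab)]
        exact congrArg _ (Subtype.ext (mul_assoc _ _ _))
      · rw [schutzenbergerMap_basis_of_notMem 𝕜 e a ⟨b * l, hb⟩ hab,
          schutzenbergerMap_basis_of_notMem 𝕜 e (a * b) l (by rw [mul_assoc]; exact hab)]
    · rw [schutzenbergerMap_basis_of_notMem 𝕜 e b l hb, map_zero,
        schutzenbergerMap_basis_of_notMem 𝕜 e (a * b) l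
          fun hab => hb (LClass.mem_of_mul_mem l.2 (by rwa [← mul_assoc]))]

/-- The right action of the maximal subgroup `G_e` on `L_e` by multiplication. -/
def LClass.rightMul {M : Type} [Monoid M] {e : M} {he : IsIdempotentElem e} (l : LClass e)
    (g : MaximalSubgroup he) : LClass e :=
  ⟨(l : M) * (g : LocalMonoid he).val, by
    obtain ⟨⟨a, ha⟩, -⟩ := mem_LClass_iff.mp l.2
    refine mem_LClass_iff.mpr ⟨⟨(g⁻¹.val : LocalMonoid he).val * a, ?_⟩,
      ⟨(l : M) * (g : LocalMonoid he).val, ?_⟩⟩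
    · calc (g⁻¹.val : LocalMonoid he).val * a * ((l : M) * (g : LocalMonoid he).val)
          = (g⁻¹.val : LocalMonoid he).val * ((a * l) * (g : LocalMonoid he).val) := by
            simp only [mul_assoc]
        _ = (g⁻¹.val * g.val : LocalMonoid he).val := by
            rw [ha, LocalMonoid.left_id, LocalMonoid.val_mul]
        _ = e := by rw [Units.inv_mul, LocalMonoid.val_one]
    · rw [mul_assoc, LocalMonoid.right_id]⟩

/-! ### Induction from a maximal subgroup and the simple module `V^♯` -/

/-- The relations `ℓg ⊗ v = ℓ ⊗ gv` (`ℓ ∈ L_e`, `g ∈ G_e`, `v ∈ V`) that cut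
`𝕜L_e ⊗_{𝕜G_e} V` out of `𝕜L_e ⊗_𝕜 V`. -/
def indRelations {𝕜 : Type} [Field 𝕜] {M : Type} [Monoid M] {e : M} (he : IsIdempotentElem e)
    {V : Type} [AddCommGroup V] [Module 𝕜 V] (ρ : Representation 𝕜 (MaximalSubgroup he) V) :
    Submodule (MonoidAlgebra 𝕜 M) ((schutzenberger 𝕜 e).asModule ⊗[𝕜] V) :=
  Submodule.span (MonoidAlgebra 𝕜 M)
    {x | ∃ (l : LClass e) (g : MaximalSubgroup he) (v : V),
      x = (schutzenberger 𝕜 e).asModuleEquiv.symm (SchutzenbergerSpace.basis 𝕜 e (LClass.rightMul l g)) ⊗ₜ[𝕜] v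
        - (schutzenberger 𝕜 e).asModuleEquiv.symm (SchutzenbergerSpace.basis 𝕜 e l) ⊗ₜ[𝕜] (ρ g v)}

/-- The induced `𝕜M`-module `Ind_{G_e}(V) = 𝕜L_e ⊗_{𝕜G_e} V`. -/
abbrev IndModule {𝕜 : Type} [Field 𝕜] {M : Type} [Monoid M] {e : M} (he : IsIdempotentElem e)
    {V : Type} [AddCommGroup V] [Module 𝕜 V] (ρ : Representation 𝕜 (MaximalSubgroup he) V) :
    Type :=
  ((schutzenberger 𝕜 e).asModule ⊗[𝕜] V) ⧸ indRelations he ρ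

/-- The submodule `N_e(W) = {w ∈ W | e𝕜M w = 0}` of a `𝕜M`-module `W`. -/
def annSubmodule (𝕜 : Type) [Field 𝕜] {M : Type} [Monoid M] (e : M)
    (W : Type) [AddCommGroup W] [Module (MonoidAlgebra 𝕜 M) W] :
    Submodule (MonoidAlgebra 𝕜 M) W where
  carrier := {w | ∀ a : MonoidAlgebra 𝕜 M, MonoidAlgebra.of 𝕜 M e • a • w = 0}
  add_mem' hx hy a := by rw [smul_add, smul_add, hx a, hy a, add_zero]
  zero_mem' a := by rw [smul_zero, smul_zero]
  smul_mem' c x hx a := by rw [smul_smul a c x]; exact hx (a * c)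

/-- The `𝕜M`-module `V^♯ = Ind_{G_e}(V) / N_e(Ind_{G_e}(V))`, which for a simple `𝕜G_e`-module
`V` is the simple `𝕜M`-module with apex `e` corresponding to `V`. -/
abbrev SimpleLift {𝕜 : Type} [Field 𝕜] {M : Type} [Monoid M] {e : M} (he : IsIdempotentElem e)
    {V : Type} [AddCommGroup V] [Module 𝕜 V] (ρ : Representation 𝕜 (MaximalSubgroup he) V) :
    Type :=
  IndModule he ρ ⧸ annSubmodule 𝕜 e (IndModule he ρ)

/-! ### Specht modules -/

/-- The cell (row, column), counted from `0`, of the entry `i` in the tableau with row lengths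
`l` that is filled with `0, 1, 2, …` row by row. -/
def tableauCell : List ℕ → ℕ → ℕ × ℕ
  | [], i => (0, i)
  | a :: l, i => if i < a then (0, i) else ((tableauCell l (i - a)).1 + 1, (tableauCell l (i - a)).2)

/-- The cell of the entry `i` in the row-by-row tableau of shape `lam`, where the parts of the
partition `lam` are the row lengths, in decreasing order. -/
def partitionCell {k : ℕ} (lam : k.Partition) (i : Fin k) : ℕ × ℕ :=
  tableauCell (lam.parts.sort (· ≥ ·)) i

/-- The sum, in the group algebra, of the permutations that preserve every row of the tableau. -/
def rowSymmetrizer {k : ℕ} (lam : k.Partition) : MonoidAlgebra ℂ (Equiv.Perm (Fin k)) :=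
  ∑ g : Equiv.Perm (Fin k) with ∀ i, (partitionCell lam (g i)).1 = (partitionCell lam i).1,
    MonoidAlgebra.of ℂ (Equiv.Perm (Fin k)) g

/-- The signed sum, in the group algebra, of the permutations that preserve every column of the
tableau. -/
def columnAntisymmetrizer {k : ℕ} (lam : k.Partition) : MonoidAlgebra ℂ (Equiv.Perm (Fin k)) :=
  ∑ g : Equiv.Perm (Fin k) with ∀ i, (partitionCell lam (g i)).2 = (partitionCell lam i).2,
    ((Equiv.Perm.sign g : ℤ) : ℂ) • MonoidAlgebra.of ℂ (Equiv.Perm (Fin k)) g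

/-- The Specht module `S(lam)`: the left ideal of the group algebra `ℂ𝔖_k` generated by the Young
symmetrizer. It is the trivial module for `lam = (k)` and the sign module for `lam = (1^k)`. -/
abbrev SpechtModule {k : ℕ} (lam : k.Partition) :
    Submodule (MonoidAlgebra ℂ (Equiv.Perm (Fin k))) (MonoidAlgebra ℂ (Equiv.Perm (Fin k))) :=
  Submodule.span _ {columnAntisymmetrizer lam * rowSymmetrizer lam}

/-- The Specht module as a representation of the symmetric group. -/
def spechtRep {k : ℕ} (lam : k.Partition) :
    Representation ℂ (Equiv.Perm (Fin k)) (SpechtModule lam) :=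
  Representation.ofModule' (SpechtModule lam)

/-- The partition `(1^r)` of `r`. -/
def onesPartition (r : ℕ) : r.Partition where
  parts := Multiset.replicate r 1
  parts_pos h := by rw [Multiset.eq_of_mem_replicate h]; exact Nat.one_pos
  parts_sum := by simp

/-! ### The full transformation monoid -/

/-- The full transformation monoid `𝔗_n`: all self-maps of an `n`-element set, the product being
composition `(fg)(i) = f(g(i))`. -/
abbrev FullTransformation (n : ℕ) : Type := Function.End (Fin n)

/-- The idempotent `e_r` of `𝔗_n`: it fixes the first `r` points and sends all others to the first
point. -/
def stdIdem (n r : ℕ) : FullTransformation n :=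
  fun i => if (i : ℕ) < r then i else ⟨0, i.pos⟩

theorem stdIdem_lt {n r : ℕ} (hr : 1 ≤ r) (i : Fin n) : (stdIdem n r i : ℕ) < r := by
  unfold stdIdem
  split_ifs with h
  · exact h
  · exact hr

theorem stdIdem_of_lt {n r : ℕ} (i : Fin n) (h : (i : ℕ) < r) : stdIdem n r i = i := if_pos h

theorem stdIdem_isIdempotent {n r : ℕ} (hr : 1 ≤ r) : IsIdempotentElem (stdIdem n r) :=
  funext fun i => stdIdem_of_lt _ (stdIdem_lt hr i)

theorem LocalMonoid.apply_lt {n r : ℕ} (hr : 1 ≤ r)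
    (f : LocalMonoid (stdIdem_isIdempotent (n := n) hr)) (i : Fin n) : (f.val i : ℕ) < r := by
  have h := congrFun f.left_id i
  rw [← h]
  exact stdIdem_lt hr _

/-- The restriction homomorphism `e_r𝔗_ne_r → 𝔗_r`, `f ↦ f|_{[r]}` (an isomorphism). -/
def restrictTransformation {n r : ℕ} (hr : 1 ≤ r) (hrn : r ≤ n) :
    LocalMonoid (stdIdem_isIdempotent (n := n) hr) →* FullTransformation r where
  toFun f := fun i => ⟨f.val (Fin.castLE hrn i), LocalMonoid.apply_lt hr f _⟩
  map_one' := by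
    funext i
    apply Fin.ext
    change ((stdIdem n r (Fin.castLE hrn i) : Fin n) : ℕ) = i
    rw [stdIdem_of_lt (Fin.castLE hrn i) i.2]
    rfl
  map_mul' f g := rfl

/-- The homomorphism `G_{e_r} → 𝔖_r`, `g ↦ g|_{[r]}` (an isomorphism). -/
def restrictPerm {n r : ℕ} (hr : 1 ≤ r) (hrn : r ≤ n) :
    MaximalSubgroup (stdIdem_isIdempotent (n := n) hr) →* Equiv.Perm (Fin r) :=
  Equiv.Perm.equivUnitsEnd.symm.toMonoidHom.comp (Units.map (restrictTransformation hr hrn))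

/-- The simple `ℂ𝔗_n`-module `L(lam) = S(lam)^♯` for a partition `lam` of `k`, `1 ≤ k ≤ n`: here
`S(lam)` is a module for `G_{e_k}` through the isomorphism `G_{e_k} ≅ 𝔖_k`. -/
def simpleModuleL {n k : ℕ} (hk : 1 ≤ k) (hkn : k ≤ n) (lam : k.Partition) :
    ModuleCat.{0} (MonoidAlgebra ℂ (FullTransformation n)) :=
  ModuleCat.of (MonoidAlgebra ℂ (FullTransformation n))
    (SimpleLift (stdIdem_isIdempotent (n := n) hk)
      ((spechtRep lam).comp (restrictPerm hk hkn)))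

end

/-! Let A_q be the space of alternating q-forms on the functions on [n], that is, the q-th exterior
power of the natural module ℂ^n. Pullback along a self-map of [n] fixes the constant function 1, so
contraction with 1 is a module map A_{q+1} → A_q. These maps form a Koszul complex, exact because
the wedge with evaluation at a point is a contracting homotopy (`contract_wedgeEval`).

For r ≥ 1 the module A_r is projective (`altModule_projective`): it is the summand of antisymmetric
tensors in ℂ𝔗_n e_r ≅ (ℂ^n)^{⊗r}. For r ≤ n it is generated by the determinant of the first r
coordinates, which e_r fixes and on which permutations of [r] act by sign. The forms annihilated by
e_r ℂ𝔗_n are exactly those with zero contraction (`contract_eq_zero_iff`), so L((1^r)) is the image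
of A_r → A_{r-1} (`simpleLiftEquivRange`), and … → A_{r+1} → A_r → L((1^r)) → 0 is a projective
resolution.

A morphism A_s → L(λ) is determined by the image of the generator, a vector fixed by e_s,
transforming by sign under 𝔖_s and killed by every map that is not injective on [s]. This forces the
morphism to vanish unless λ = (1^s) (`hom_simpleLift_eq_zero`), in which case all morphisms are
multiples of the projection (`hom_range_koszulMap`). In either case they vanish on the next syzygy
(`koszulInclusion_comp`), so the resolution is minimal and Ext^m(L((1^r)), L(λ)) ≅ Hom(A_{r+m},
L(λ)). -/

noncomputable section

/-! ### Extension groups from a resolution on which the Hom differentials vanish -/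

namespace CategoryTheory.Abelian.Ext

universe w v u

variable {C : Type u} [Category.{v} C] [Abelian C] [HasExt.{w} C]
  {𝕜 : Type} [Field 𝕜] [Linear 𝕜 C]

/-- Dimension shifting along a short exact sequence with projective middle term. -/
theorem nonempty_linearEquiv_succ {S : ShortComplex C} (hS : S.ShortExact) [Projective S.X₂]
    (Y : C) (h : ∀ φ : S.X₂ ⟶ Y, S.f ≫ φ = 0) (m : ℕ) :
    Nonempty (Ext S.X₃ Y (m + 1) ≃ₗ[𝕜] Ext S.X₁ Y m) := by
  refine ⟨(LinearEquiv.ofBijective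
    (precompOfLinear hS.extClass 𝕜 Y (add_comm 1 m)) ⟨?_, ?_⟩).symm⟩
  · rw [injective_iff_map_eq_zero]
    intro x hx
    obtain ⟨y, rfl⟩ := contravariant_sequence_exact₁ hS Y x (add_comm 1 m) hx
    cases m with
    | zero =>
      -- In degree zero projectivity does not kill `y`; the assumption `h` on morphisms out of the
      -- middle term does.
      obtain ⟨φ, rfl⟩ := addEquiv₀.symm.surjective y
      change (mk₀ S.f).comp (mk₀ φ) _ = 0
      rw [mk₀_comp_mk₀, h, mk₀_zero]
    | succ m => rw [eq_zero_of_projective y, comp_zero]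
  · intro x
    obtain ⟨y, hy⟩ := contravariant_sequence_exact₃ hS Y x (eq_zero_of_projective _) (add_comm 1 m)
    exact ⟨y, hy⟩

/-- If every morphism from a term of a projective resolution to `Y` restricts to zero on the next
syzygy, the extension groups are the groups of such morphisms. -/
theorem nonempty_linearEquiv_hom_of_resolution {P K : ℕ → C} (ι : ∀ i, K (i + 1) ⟶ P i)
    (π : ∀ i, P i ⟶ K i) (w : ∀ i, ι i ≫ π i = 0)
    (hS : ∀ i, (ShortComplex.mk (ι i) (π i) (w i)).ShortExact) [∀ i, Projective (P i)]
    (Y : C) (h : ∀ i (φ : P i ⟶ Y), ι i ≫ φ = 0) (m : ℕ) :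
    ∀ i, Nonempty (Ext (K i) Y m ≃ₗ[𝕜] (P (i + m) ⟶ Y)) := by
  induction m with
  | zero =>
    intro i
    -- By `h`, every morphism from `P i` kills the kernel of `π i`, hence factors through `K i`.
    refine ⟨linearEquiv₀.trans (LinearEquiv.ofBijective
      (Linear.leftComp 𝕜 Y (π i)) ⟨?_, ?_⟩)⟩
    · intro a b hab
      have := (hS i).epi_g
      exact (cancel_epi (π i)).mp hab
    · intro φ
      have := (hS i).epi_g
      exact ⟨(hS i).exact.desc φ (h i φ), (hS i).exact.g_desc φ (h i φ)⟩
  | succ m ih =>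
    intro i
    have : Projective (ShortComplex.mk (ι i) (π i) (w i)).X₂ := inferInstanceAs (Projective (P i))
    obtain ⟨e⟩ := nonempty_linearEquiv_succ (𝕜 := 𝕜) (hS i) Y (h i) m
    obtain ⟨e'⟩ := ih (i + 1)
    rw [show i + (m + 1) = i + 1 + m by omega]
    exact ⟨e.trans e'⟩

/-- An isomorphism in the first argument induces an isomorphism of extension groups. -/
def congrLeft {X X' : C} (i : X ≅ X') (Y : C) (m : ℕ) : Ext X' Y m ≃ₗ[𝕜] Ext X Y m :=
  LinearEquiv.ofLinearMap (precompOfLinear (mk₀ i.hom) 𝕜 Y (zero_add m))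
    (precompOfLinear (mk₀ i.inv) 𝕜 Y (zero_add m))
    (by
      ext x
      change (mk₀ i.hom).comp ((mk₀ i.inv).comp x (zero_add m)) (zero_add m) = x
      rw [mk₀_comp_mk₀_assoc, i.hom_inv_id, mk₀_id_comp])
    (by
      ext x
      change (mk₀ i.inv).comp ((mk₀ i.hom).comp x (zero_add m)) (zero_add m) = x
      rw [mk₀_comp_mk₀_assoc, i.inv_hom_id, mk₀_id_comp])

end CategoryTheory.Abelian.Ext

/-! ### Alternating forms and the exact Koszul contraction -/

/-- The action of the full transformation monoid on alternating forms on `Fin n → ℂ`. -/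
def altRep (n q : ℕ) :
    Representation ℂ (FullTransformation n) ((Fin n → ℂ) [⋀^Fin q]→ₗ[ℂ] ℂ) where
  toFun f :=
    { toFun c := c.compLinearMap (LinearMap.funLeft ℂ ℂ f)
      map_add' _ _ := rfl
      map_smul' _ _ := rfl }
  map_one' := rfl
  map_mul' _ _ := rfl

theorem altRep_apply (n q : ℕ) (f : FullTransformation n)
    (c : (Fin n → ℂ) [⋀^Fin q]→ₗ[ℂ] ℂ) (v : Fin q → Fin n → ℂ) :
    altRep n q f c v = c fun i j => v i (f j) := rfl

/-- The contraction of an alternating form with the constant function `1`. -/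
def contract (n q : ℕ) :
    ((Fin n → ℂ) [⋀^Fin (q + 1)]→ₗ[ℂ] ℂ) →ₗ[ℂ] ((Fin n → ℂ) [⋀^Fin q]→ₗ[ℂ] ℂ) where
  toFun c := c.curryLeft 1
  map_add' _ _ := rfl
  map_smul' _ _ := rfl

theorem contract_apply (n q : ℕ) (c : (Fin n → ℂ) [⋀^Fin (q + 1)]→ₗ[ℂ] ℂ)
    (v : Fin q → Fin n → ℂ) : contract n q c v = c (Matrix.vecCons 1 v) := rfl

/-- The constant function 1 is its own pullback along any self-map. -/
theorem contract_altRep (n q : ℕ) (f : FullTransformation n)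
    (c : (Fin n → ℂ) [⋀^Fin (q + 1)]→ₗ[ℂ] ℂ) :
    contract n q (altRep n (q + 1) f c) = altRep n q f (contract n q c) := by
  ext v
  simp only [contract_apply, altRep_apply]
  congr 1
  funext i
  refine Fin.cases ?_ (fun i => ?_) i <;> rfl

/-- Exterior multiplication with the evaluation at a point. -/
def wedgeEval {n : ℕ} (p : Fin n) (q : ℕ) (c : (Fin n → ℂ) [⋀^Fin q]→ₗ[ℂ] ℂ) :
    (Fin n → ℂ) [⋀^Fin (q + 1)]→ₗ[ℂ] ℂ :=
  AlternatingMap.alternatizeUncurryFin ((LinearMap.proj (R := ℂ) p).smulRight c)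

theorem wedgeEval_apply {n : ℕ} (p : Fin n) (q : ℕ) (c : (Fin n → ℂ) [⋀^Fin q]→ₗ[ℂ] ℂ)
    (v : Fin (q + 1) → Fin n → ℂ) :
    wedgeEval p q c v = ∑ i : Fin (q + 1), (-1) ^ (i : ℕ) * (v i p * c (i.removeNth v)) := by
  rw [wedgeEval, AlternatingMap.alternatizeUncurryFin_apply]
  refine Finset.sum_congr rfl fun i _ => ?_
  simp

/-- Contraction is an antiderivation and evaluation at `p` takes the value 1 on the constant
function. The wedge is therefore a contracting homotopy; it is only linear, not equivariant, which
is enough for exactness. -/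
theorem contract_wedgeEval {n : ℕ} (p : Fin n) (q : ℕ)
    (c : (Fin n → ℂ) [⋀^Fin (q + 1)]→ₗ[ℂ] ℂ) :
    contract n (q + 1) (wedgeEval p (q + 1) c) + wedgeEval p q (contract n q c) = c := by
  ext v
  rw [AlternatingMap.add_apply, contract_apply, wedgeEval_apply, wedgeEval_apply,
    Fin.sum_univ_succ]
  simp only [contract_apply]
  have h0 : (0 : Fin (q + 2)).removeNth (Matrix.vecCons (1 : Fin n → ℂ) v) = v := rfl
  have hs : ∀ i : Fin (q + 1), i.succ.removeNth (Matrix.vecCons (1 : Fin n → ℂ) v) =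
      Matrix.vecCons 1 (i.removeNth v) := by
    intro i
    funext j
    refine Fin.cases ?_ (fun j => ?_) j
    · simp [Fin.removeNth]
    · simp [Fin.removeNth]
  simp only [h0, hs, Matrix.cons_val_zero, Matrix.cons_val_succ, Fin.val_succ, pow_succ]
  simp

theorem contract_contract (n q : ℕ) (c : (Fin n → ℂ) [⋀^Fin (q + 2)]→ₗ[ℂ] ℂ) :
    contract n q (contract n (q + 1) c) = 0 :=
  AlternatingMap.curryLeft_same c 1

theorem ker_contract (n q : ℕ) :
    LinearMap.ker (contract n q) = LinearMap.range (contract n (q + 1)) := by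
  apply le_antisymm
  · intro c hc
    rw [LinearMap.mem_ker] at hc
    -- The homotopy needs a point of `Fin n`; without one, forms of positive degree vanish.
    rcases Nat.eq_zero_or_pos n with rfl | hn
    · refine ⟨0, ?_⟩
      ext v
      have : v 0 = 0 := Subsingleton.elim _ _
      rw [map_zero, AlternatingMap.zero_apply, c.map_coord_zero 0 this]
    · have h := contract_wedgeEval ⟨0, hn⟩ q c
      refine ⟨wedgeEval ⟨0, hn⟩ (q + 1) c, ?_⟩
      have h0 : wedgeEval (⟨0, hn⟩ : Fin n) q 0 = 0 := by
        ext v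
        simp [wedgeEval_apply]
      rwa [hc, h0, add_zero] at h
  · rintro _ ⟨c, rfl⟩
    exact contract_contract n q c

/-! ### The coordinate determinant and the action of e_r -/

/-- The alternating form given by the determinant of the first `r` coordinates. -/
def coordDet {n r : ℕ} (hrn : r ≤ n) : (Fin n → ℂ) [⋀^Fin r]→ₗ[ℂ] ℂ :=
  Matrix.detRowAlternating.compLinearMap (LinearMap.funLeft ℂ ℂ (Fin.castLE hrn))

theorem coordDet_apply {n r : ℕ} (hrn : r ≤ n) (v : Fin r → Fin n → ℂ) :
    coordDet hrn v = Matrix.det (Matrix.of fun i j => v i (Fin.castLE hrn j)) := rfl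

/-- The transformation of `Fin n` that extends a map on the first `r` points and sends every other
point where it sends the first. -/
def extendMap {n r : ℕ} (hr : 1 ≤ r) (s : Fin r → Fin n) : FullTransformation n :=
  fun i => if h : (i : ℕ) < r then s ⟨i, h⟩ else s ⟨0, hr⟩

theorem extendMap_castLE {n r : ℕ} (hr : 1 ≤ r) (hrn : r ≤ n) (s : Fin r → Fin n) (i : Fin r) :
    extendMap hr s (Fin.castLE hrn i) = s i := dif_pos i.2

theorem mul_extendMap {n r : ℕ} (hr : 1 ≤ r) (f : FullTransformation n) (s : Fin r → Fin n) :
    f * extendMap hr s = extendMap hr (f ∘ s) := by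
  funext i
  change f (extendMap hr s i) = _
  unfold extendMap
  split_ifs <;> rfl

theorem extendMap_comp_castLE {n r : ℕ} (hr : 1 ≤ r) (hrn : r ≤ n) (f : FullTransformation n) :
    extendMap hr (f ∘ Fin.castLE hrn) = f * stdIdem n r := by
  funext i
  change _ = f (stdIdem n r i)
  unfold extendMap stdIdem
  split_ifs <;> rfl

theorem altRep_coordDet {n r : ℕ} (hrn : r ≤ n) (f : FullTransformation n)
    (v : Fin r → Fin n → ℂ) :
    altRep n r f (coordDet hrn) v = Matrix.det (Matrix.of fun i j => v i (f (Fin.castLE hrn j))) :=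
  rfl

/-- An alternating form is determined by its values on the standard basis. -/
theorem alternating_ext_single {n r : ℕ} {c d : (Fin n → ℂ) [⋀^Fin r]→ₗ[ℂ] ℂ}
    (h : ∀ t : Fin r → Fin n, c (fun i => Pi.single (t i) 1) = d (fun i => Pi.single (t i) 1)) :
    c = d := by
  refine Module.Basis.ext_alternating (Pi.basisFun ℂ (Fin n)) fun t _ => ?_
  simpa using h t

theorem alternating_eq_zero_of_lt {n r : ℕ} (h : n < r) (c : (Fin n → ℂ) [⋀^Fin r]→ₗ[ℂ] ℂ) :
    c = 0 := by
  refine Module.Basis.ext_alternating (Pi.basisFun ℂ (Fin n)) fun t ht => ?_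
  have := Fintype.card_le_of_injective t ht
  simp only [Fintype.card_fin] at this
  omega

/-- The map extending `s` carries the determinant to the wedge of the evaluations at the points `s
i`, so this is the expansion of `c` in coordinate wedges, with each basis wedge counted once for
every ordering of its points. It shows both that the determinant generates and that r! must be
inverted in the splitting. -/
theorem sum_extendMap_coordDet {n r : ℕ} (hr : 1 ≤ r) (hrn : r ≤ n)
    (c : (Fin n → ℂ) [⋀^Fin r]→ₗ[ℂ] ℂ) :
    ∑ s : Fin r → Fin n, c (fun i => Pi.single (s i) 1) •
      altRep n r (extendMap hr s) (coordDet hrn) = (r.factorial : ℂ) • c := by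
  refine alternating_ext_single fun t => ?_
  rw [show ∀ d : (Fin r → Fin n) → (Fin n → ℂ) [⋀^Fin r]→ₗ[ℂ] ℂ,
      (∑ s, d s) (fun i => Pi.single (t i) 1) = ∑ s, d s fun i => Pi.single (t i) 1 from fun d =>
      map_sum (AddMonoidHom.mk' (fun e : (Fin n → ℂ) [⋀^Fin r]→ₗ[ℂ] ℂ =>
        e fun i => Pi.single (t i) 1) fun _ _ => rfl) d _]
  simp only [AlternatingMap.smul_apply, altRep_coordDet, extendMap_castLE, Matrix.det_apply,
    Matrix.of_apply, Finset.mul_sum, smul_eq_mul]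
  rw [Finset.sum_comm]
  have key : ∀ σ : Equiv.Perm (Fin r),
      ∑ s : Fin r → Fin n, c (fun i => Pi.single (s i) 1) *
        (Equiv.Perm.sign σ • ∏ i, (Pi.single (t (σ i)) (1 : ℂ) : Fin n → ℂ) (s i)) =
      c (fun i => Pi.single (t i) 1) := by
    intro σ
    -- Only `s = t ∘ σ` makes the product of coordinates nonzero; the sign from permuting the
    -- arguments of `c` then cancels the sign in the determinant.
    rw [Finset.sum_eq_single (t ∘ σ)]
    · have h1 := c.map_perm (fun i => (Pi.single (t i) (1 : ℂ) : Fin n → ℂ)) σ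
      have h2 : ((fun i => (Pi.single (t i) (1 : ℂ) : Fin n → ℂ)) ∘ σ) =
        fun i => Pi.single ((t ∘ σ) i) 1 := rfl
      rw [h2] at h1
      rw [h1]
      rcases Int.units_eq_one_or (Equiv.Perm.sign σ) with h | h <;> simp [h]
    · intro s _ hs
      obtain ⟨i, hi⟩ := Function.ne_iff.mp hs
      rw [Finset.prod_eq_zero (Finset.mem_univ i), smul_zero, mul_zero]
      exact Pi.single_eq_of_ne hi _
    · simp
  rw [Finset.sum_congr rfl fun σ _ => key σ]
  simp [Fintype.card_perm]

/-- The idempotent factors through [r], and top-degree forms on ℂ^r are multiples of the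
determinant. Hence e_r A_r is at most a line, which controls all endomorphism-type computations
below. -/
theorem altRep_stdIdem {n r : ℕ} (hr : 1 ≤ r) (hrn : r ≤ n) (c : (Fin n → ℂ) [⋀^Fin r]→ₗ[ℂ] ℂ) :
    ∃ a : ℂ, altRep n r (stdIdem n r) c = a • coordDet hrn := by
  let p : Fin n → Fin r := fun i => if h : (i : ℕ) < r then ⟨i, h⟩ else ⟨0, hr⟩
  have hp : stdIdem n r = Fin.castLE hrn ∘ p := by
    funext i
    simp only [stdIdem, p, Function.comp]
    split_ifs <;> rfl
  have h := AlternatingMap.eq_smul_basis_det (Pi.basisFun ℂ (Fin r))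
    (c.compLinearMap (LinearMap.funLeft ℂ ℂ p))
  have h' := congrArg
    (fun d => d.compLinearMap (LinearMap.funLeft ℂ ℂ (Fin.castLE hrn))) h
  rw [Pi.basisFun_det] at h'
  exact ⟨_, (congrArg (fun f => altRep n r f c) hp).trans h'⟩

theorem contract_coordDet_ne_zero {n q : ℕ} (hn : q + 1 ≤ n) :
    contract n q (coordDet hn) ≠ 0 := by
  intro h
  -- Evaluated on the coordinate functions of the points 1, …, q (counted from 0), the contraction
  -- is the determinant of a matrix whose first row is all ones and whose other rows are standard
  -- basis vectors: upper triangular with unit diagonal.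
  have h1 := DFunLike.congr_fun h
    (fun i : Fin q => (Pi.single (Fin.castLE hn i.succ) 1 : Fin n → ℂ))
  rw [contract_apply, coordDet_apply, Matrix.det_of_isUpperTriangular] at h1
  · rw [Finset.prod_eq_one, AlternatingMap.zero_apply] at h1
    · exact one_ne_zero h1
    · intro i _
      refine Fin.cases ?_ (fun i => ?_) i <;> simp
  · intro i j hij
    revert hij
    refine Fin.cases ?_ (fun i => ?_) i
    · intro hij
      exact absurd hij (Fin.not_lt_zero _)
    · intro hij
      simp only [Matrix.of_apply, Matrix.cons_val_succ]
      refine Pi.single_eq_of_ne (fun h => ?_) _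
      exact absurd (Fin.castLE_injective hn h) (ne_of_lt hij)

theorem coordDet_ne_zero {n r : ℕ} (hr : 1 ≤ r) (hrn : r ≤ n) : coordDet hrn ≠ 0 := by
  obtain ⟨q, rfl⟩ := Nat.exists_eq_add_of_le' hr
  intro h
  exact contract_coordDet_ne_zero hrn (by rw [h, map_zero])

/-- The forms that `e_r M` annihilates are those with zero contraction. -/
theorem contract_eq_zero_iff {n q : ℕ} (hn : q + 1 ≤ n) (c : (Fin n → ℂ) [⋀^Fin (q + 1)]→ₗ[ℂ] ℂ) :
    contract n q c = 0 ↔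
      ∀ f : FullTransformation n, altRep n (q + 1) (stdIdem n (q + 1)) (altRep n (q + 1) f c) = 0 := by
  constructor
  · intro h f
    obtain ⟨a, ha⟩ := altRep_stdIdem (Nat.le_add_left 1 q) hn (altRep n (q + 1) f c)
    -- The scalar `a` is detected by contraction, since the determinant has nonzero contraction and
    -- contraction is equivariant.
    have h1 := congrArg (contract n q) ha
    rw [contract_altRep, contract_altRep, h, map_zero, map_zero, map_smul] at h1
    rcases smul_eq_zero.mp h1.symm with h2 | h2
    · rw [ha, h2, zero_smul]
    · exact absurd h2 (contract_coordDet_ne_zero hn)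
  · intro h
    refine Module.Basis.ext_alternating (Pi.basisFun ℂ (Fin n)) fun t ht => ?_
    -- `f` sends `t i` to the point `i + 1` and all other points to 0. Pullback along `f` turns the
    -- coordinate function of `i + 1` into that of `t i` and fixes 1, so the value of the
    -- contraction on the basis vectors `t` is a value of e_r f c.
    let f : FullTransformation n := fun j =>
      if hj : ∃ i, t i = j then Fin.castLE hn hj.choose.succ else Fin.castLE hn 0
    have hf : ∀ j, stdIdem n (q + 1) (f j) = f j := by
      intro j
      refine stdIdem_of_lt _ ?_
      simp only [f]
      split_ifs <;> simp
    have h1 := DFunLike.congr_fun (h f)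
      (Matrix.vecCons 1 fun i : Fin q => (Pi.single (Fin.castLE hn i.succ) 1 : Fin n → ℂ))
    rw [altRep_apply, altRep_apply] at h1
    rw [contract_apply]
    refine Eq.trans (congrArg c ?_) h1
    funext i
    refine Fin.cases ?_ (fun i => ?_) i
    · rfl
    · funext j
      simp only [Matrix.cons_val_succ, hf, Pi.basisFun_apply]
      by_cases hj : t i = j
      · have hex : ∃ i, t i = j := ⟨i, hj⟩
        have hi : hex.choose = i := ht (hex.choose_spec.trans hj.symm)
        have hfj : f j = Fin.castLE hn i.succ := by simp only [f, dif_pos hex, hi]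
        rw [hfj, ← hj, Pi.single_eq_same, Pi.single_eq_same]
      · rw [Pi.single_eq_of_ne (Ne.symm hj), Pi.single_eq_of_ne]
        intro hfj
        simp only [f] at hfj
        split_ifs at hfj with hex
        · have := Fin.succ_injective _ (Fin.castLE_injective hn hfj)
          exact hj (this ▸ hex.choose_spec)
        · exact absurd (Fin.castLE_injective hn hfj) (Fin.succ_ne_zero i).symm

theorem altRep_coordDet_eq_zero {n r : ℕ} (hrn : r ≤ n) (f : FullTransformation n)
    (hf : ¬ Function.Injective fun i => f (Fin.castLE hrn i)) :
    altRep n r f (coordDet hrn) = 0 := by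
  ext v
  rw [altRep_coordDet]
  simp only [Function.Injective, not_forall] at hf
  obtain ⟨i, j, hij, hne⟩ := hf
  exact Matrix.det_zero_of_column_eq hne fun k => by simp [hij]

theorem altRep_coordDet_perm {n r : ℕ} (hrn : r ≤ n) (f : FullTransformation n)
    (σ : Equiv.Perm (Fin r)) (hf : ∀ i, f (Fin.castLE hrn i) = Fin.castLE hrn (σ i)) :
    altRep n r f (coordDet hrn) = ((Equiv.Perm.sign σ : ℤ) : ℂ) • coordDet hrn := by
  ext v
  rw [altRep_coordDet, AlternatingMap.smul_apply, coordDet_apply, smul_eq_mul,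
    ← Matrix.det_permute' σ]
  simp only [hf]
  rfl

/-! ### Forms as modules: projectivity, the Koszul differential, morphisms -/

/-- The module of alternating `q`-forms over the algebra of the full transformation monoid. -/
abbrev AltModule (n q : ℕ) : Type := (altRep n q).asModule

theorem of_smul_altModule {n q : ℕ} (f : FullTransformation n)
    (c : (Fin n → ℂ) [⋀^Fin q]→ₗ[ℂ] ℂ) :
    MonoidAlgebra.of ℂ (FullTransformation n) f • (altRep n q).asModuleEquiv.symm c =
      (altRep n q).asModuleEquiv.symm (altRep n q f c) :=
  ((altRep n q).asModuleEquiv_symm_map_rho f c).symm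

theorem alternating_apply_eq_sum {n r : ℕ} (c : (Fin n → ℂ) [⋀^Fin r]→ₗ[ℂ] ℂ)
    (v : Fin r → Fin n → ℂ) :
    c v = ∑ s : Fin r → Fin n, (∏ i, v i (s i)) * c fun i => Pi.single (s i) 1 := by
  have h : v = fun i => ∑ j, v i j • (Pi.single j 1 : Fin n → ℂ) := by
    funext i
    exact pi_eq_sum_univ' (v i)
  conv_lhs => rw [h]
  refine (c.toMultilinearMap.map_sum _).trans (Finset.sum_congr rfl fun s _ => ?_)
  exact c.toMultilinearMap.map_smul_univ _ _

/-- A multiple of the embedding of the module of forms into the regular module. -/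
def altToRegular {n r : ℕ} (hr : 1 ≤ r) :
    AltModule n r →ₗ[ℂ] MonoidAlgebra ℂ (FullTransformation n) where
  toFun c := ∑ s : Fin r → Fin n, (altRep n r).asModuleEquiv c (fun i => Pi.single (s i) 1) •
    MonoidAlgebra.of ℂ (FullTransformation n) (extendMap hr s)
  map_add' c d := by
    simp only [map_add, AlternatingMap.add_apply, add_smul, Finset.sum_add_distrib]
  map_smul' a c := by
    simp only [map_smul, AlternatingMap.smul_apply, smul_assoc, Finset.smul_sum, RingHom.id_apply]

theorem altToRegular_apply {n r : ℕ} (hr : 1 ≤ r) (c : AltModule n r) :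
    altToRegular hr c = ∑ s : Fin r → Fin n,
      (altRep n r).asModuleEquiv c (fun i => Pi.single (s i) 1) •
        MonoidAlgebra.of ℂ (FullTransformation n) (extendMap hr s) := rfl

/-- The maps `extendMap hr s` are permuted by left multiplication exactly as the basis tensors of
(ℂ^n)^{⊗r} indexed by `s`, and a form is sent to its tensor of coefficients. The coefficient of `f •
c` at `t` collects those of `c` at all `s` with `f ∘ s = t`. -/
theorem altToRegular_of_smul {n r : ℕ} (hr : 1 ≤ r) (f : FullTransformation n)
    (c : AltModule n r) :
    altToRegular hr (MonoidAlgebra.of ℂ (FullTransformation n) f • c) =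
      MonoidAlgebra.of ℂ (FullTransformation n) f • altToRegular hr c := by
  obtain ⟨c, rfl⟩ := (altRep n r).asModuleEquiv.symm.surjective c
  rw [of_smul_altModule, altToRegular_apply, altToRegular_apply]
  simp only [LinearEquiv.apply_symm_apply, smul_eq_mul, Finset.mul_sum,
    mul_smul_comm, ← map_mul, mul_extendMap]
  have hx : ∀ t : Fin r → Fin n, altRep n r f c (fun i => Pi.single (t i) 1) =
      ∑ s : Fin r → Fin n, (∏ i, (Pi.single (t i) (1 : ℂ) : Fin n → ℂ) ((f ∘ s) i)) *
        c fun i => Pi.single (s i) 1 := fun t => alternating_apply_eq_sum c _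
  simp only [hx, Finset.sum_smul]
  rw [Finset.sum_comm]
  refine Finset.sum_congr rfl fun s _ => ?_
  rw [Finset.sum_eq_single (f ∘ s)]
  · rw [Finset.prod_eq_one, one_mul]
    intro i _
    exact Pi.single_eq_same _ _
  · intro t _ ht
    obtain ⟨i, hi⟩ := Function.ne_iff.mp ht
    rw [Finset.prod_eq_zero (Finset.mem_univ i), zero_mul, zero_smul]
    exact Pi.single_eq_of_ne (Ne.symm hi) _
  · simp

/-- The section of the presentation of `AltModule n r` by its generator. -/
def altSection {n r : ℕ} (hr : 1 ≤ r) :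
    AltModule n r →ₗ[MonoidAlgebra ℂ (FullTransformation n)]
      MonoidAlgebra ℂ (FullTransformation n) :=
  MonoidAlgebra.equivariantOfLinearOfComm ((r.factorial : ℂ)⁻¹ • altToRegular hr) fun f c => by
    rw [LinearMap.smul_apply, LinearMap.smul_apply, smul_comm]
    exact congrArg _ (altToRegular_of_smul hr f c)

/-- The generator of the module of alternating forms. -/
def altGen {n r : ℕ} (hrn : r ≤ n) : AltModule n r :=
  (altRep n r).asModuleEquiv.symm (coordDet hrn)

theorem altSection_smul_altGen {n r : ℕ} (hr : 1 ≤ r) (hrn : r ≤ n) (c : AltModule n r) :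
    altSection hr c • altGen hrn = c := by
  obtain ⟨c, rfl⟩ := (altRep n r).asModuleEquiv.symm.surjective c
  have h := congrArg (altRep n r).asModuleEquiv.symm (sum_extendMap_coordDet hr hrn c)
  have hr0 : (r.factorial : ℂ) ≠ 0 := Nat.cast_ne_zero.mpr r.factorial_ne_zero
  change ((r.factorial : ℂ)⁻¹ • altToRegular hr _) • altGen hrn = _
  rw [smul_assoc, inv_smul_eq_iff₀ hr0, ← map_smul, ← h, altToRegular_apply, Finset.sum_smul,
    map_sum]
  refine Finset.sum_congr rfl fun s _ => ?_
  rw [smul_assoc, altGen, of_smul_altModule, map_smul, LinearEquiv.apply_symm_apply]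

theorem altModule_hom_eq_zero {n r : ℕ} (hr : 1 ≤ r) (hrn : r ≤ n) {X : Type*} [AddCommGroup X]
    [Module (MonoidAlgebra ℂ (FullTransformation n)) X]
    (φ : AltModule n r →ₗ[MonoidAlgebra ℂ (FullTransformation n)] X) (h : φ (altGen hrn) = 0) :
    φ = 0 := by
  ext c
  rw [← altSection_smul_altGen hr hrn c, map_smul, h, smul_zero, LinearMap.zero_apply]

theorem altModule_subsingleton {n r : ℕ} (h : n < r) : Subsingleton (AltModule n r) :=
  ⟨fun a b => (alternating_eq_zero_of_lt h a).trans (alternating_eq_zero_of_lt h b).symm⟩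

/-- Up to the factor 1/r!, the embedding in the regular module splits the map a ↦ a · generator;
above degree n the module is zero. -/
theorem altModule_projective {n r : ℕ} (hr : 1 ≤ r) :
    Module.Projective (MonoidAlgebra ℂ (FullTransformation n)) (AltModule n r) := by
  rcases le_or_gt r n with hrn | hrn
  · refine Module.Projective.of_split (altSection hr)
      (LinearMap.toSpanSingleton (MonoidAlgebra ℂ (FullTransformation n)) _ (altGen hrn)) ?_
    ext c
    exact altSection_smul_altGen hr hrn c
  · have := altModule_subsingleton hrn
    infer_instance

/-- The differential of the Koszul complex. -/
def koszulMap (n q : ℕ) :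
    AltModule n (q + 1) →ₗ[MonoidAlgebra ℂ (FullTransformation n)] AltModule n q :=
  MonoidAlgebra.equivariantOfLinearOfComm ((altRep n q).asModuleEquiv.symm.toLinearMap ∘ₗ
    contract n q ∘ₗ (altRep n (q + 1)).asModuleEquiv.toLinearMap) fun f c => by
    obtain ⟨c, rfl⟩ := (altRep n (q + 1)).asModuleEquiv.symm.surjective c
    have h1 := of_smul_altModule f c
    have h2 := of_smul_altModule f (contract n q c)
    rw [MonoidAlgebra.of_apply] at h1 h2
    simp only [LinearMap.comp_apply, LinearEquiv.coe_coe, LinearEquiv.apply_symm_apply, h1, h2,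
      contract_altRep]

theorem ker_koszulMap (n q : ℕ) :
    LinearMap.ker (koszulMap n q) = LinearMap.range (koszulMap n (q + 1)) := by
  ext c
  exact SetLike.ext_iff.mp (ker_contract n q) c

theorem koszulMap_altGen_ne_zero {n q : ℕ} (hn : q + 1 ≤ n) : koszulMap n q (altGen hn) ≠ 0 :=
  contract_coordDet_ne_zero hn

theorem altGen_ne_zero {n r : ℕ} (hr : 1 ≤ r) (hrn : r ≤ n) : altGen hrn ≠ 0 :=
  coordDet_ne_zero hr hrn

theorem stdIdem_smul_altModule {n r : ℕ} (hr : 1 ≤ r) (hrn : r ≤ n) (c : AltModule n r) :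
    ∃ a : ℂ, MonoidAlgebra.of ℂ (FullTransformation n) (stdIdem n r) • c = a • altGen hrn := by
  obtain ⟨c, rfl⟩ := (altRep n r).asModuleEquiv.symm.surjective c
  obtain ⟨a, ha⟩ := altRep_stdIdem hr hrn c
  exact ⟨a, by rw [of_smul_altModule, ha, map_smul, altGen]⟩

theorem of_smul_altGen_perm {n r : ℕ} (hrn : r ≤ n) (f : FullTransformation n)
    (σ : Equiv.Perm (Fin r)) (hf : ∀ i, f (Fin.castLE hrn i) = Fin.castLE hrn (σ i)) :
    MonoidAlgebra.of ℂ (FullTransformation n) f • altGen hrn =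
      ((Equiv.Perm.sign σ : ℤ) : ℂ) • altGen hrn := by
  rw [altGen, of_smul_altModule, altRep_coordDet_perm hrn f σ hf, map_smul]

theorem of_smul_altGen_eq_zero {n r : ℕ} (hrn : r ≤ n) (f : FullTransformation n)
    (hf : ¬ Function.Injective fun i => f (Fin.castLE hrn i)) :
    MonoidAlgebra.of ℂ (FullTransformation n) f • altGen hrn = 0 := by
  rw [altGen, of_smul_altModule, altRep_coordDet_eq_zero hrn f hf, map_zero]

theorem stdIdem_smul_altGen {n r : ℕ} (hrn : r ≤ n) :
    MonoidAlgebra.of ℂ (FullTransformation n) (stdIdem n r) • altGen hrn = altGen hrn := by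
  rw [of_smul_altGen_perm hrn _ 1 fun i => stdIdem_of_lt _ i.2]
  simp

theorem mem_annSubmodule_iff {M : Type} [Monoid M] {e : M} {W : Type} [AddCommGroup W]
    [Module (MonoidAlgebra ℂ M) W] (w : W) :
    w ∈ annSubmodule ℂ e W ↔
      ∀ f : M, MonoidAlgebra.of ℂ M e • MonoidAlgebra.of ℂ M f • w = 0 := by
  constructor
  · intro h f
    exact h _
  · intro h a
    induction a using MonoidAlgebra.induction_on with
    | of f => exact h f
    | add a b ha hb => rw [add_smul, smul_add, ha, hb, add_zero]
    | smul r a ha =>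
      rw [Algebra.smul_def, mul_smul, ← mul_smul, ← Algebra.commutes, mul_smul, ha, smul_zero]

theorem ker_koszulMap_eq_annSubmodule {n q : ℕ} (hn : q + 1 ≤ n) :
    LinearMap.ker (koszulMap n q) = annSubmodule ℂ (stdIdem n (q + 1)) (AltModule n (q + 1)) := by
  ext c
  obtain ⟨c, rfl⟩ := (altRep n (q + 1)).asModuleEquiv.symm.surjective c
  rw [mem_annSubmodule_iff, LinearMap.mem_ker]
  simp only [of_smul_altModule]
  exact contract_eq_zero_iff hn c

/-- Lift the image of the generator to a form `d`. As e_{q+1} fixes the generator, `d` may be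
replaced by e_{q+1}`d`, which is a multiple of the generator. -/
theorem hom_range_koszulMap {n q : ℕ} (hn : q + 1 ≤ n)
    (φ : AltModule n (q + 1) →ₗ[MonoidAlgebra ℂ (FullTransformation n)]
      LinearMap.range (koszulMap n q)) :
    ∃ a : ℂ, ∀ c, φ c = algebraMap ℂ (MonoidAlgebra ℂ (FullTransformation n)) a •
      (koszulMap n q).rangeRestrict c := by
  obtain ⟨d, hd⟩ := (koszulMap n q).surjective_rangeRestrict (φ (altGen hn))
  obtain ⟨a, ha⟩ := stdIdem_smul_altModule (Nat.le_add_left 1 q) hn d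
  refine ⟨a, fun c => ?_⟩
  have h : φ (altGen hn) = algebraMap ℂ (MonoidAlgebra ℂ (FullTransformation n)) a •
      (koszulMap n q).rangeRestrict (altGen hn) := by
    rw [← map_smul, algebraMap_smul, ← ha, map_smul, hd, ← map_smul, stdIdem_smul_altGen]
  rw [← altSection_smul_altGen (Nat.le_add_left 1 q) hn c, map_smul, h, map_smul, ← mul_smul,
    ← mul_smul, Algebra.commutes]

/-! ### The sign-isotypic part of Specht modules -/

/-- The signed sum of all permutations. -/
def signSum (k : ℕ) : MonoidAlgebra ℂ (Equiv.Perm (Fin k)) :=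
  ∑ g : Equiv.Perm (Fin k), ((Equiv.Perm.sign g : ℤ) : ℂ) • MonoidAlgebra.of ℂ (Equiv.Perm (Fin k)) g

theorem sign_mul_sign_complex {k : ℕ} (h : Equiv.Perm (Fin k)) :
    ((Equiv.Perm.sign h : ℤ) : ℂ) * ((Equiv.Perm.sign h : ℤ) : ℂ) = 1 := by
  rcases Int.units_eq_one_or (Equiv.Perm.sign h) with h | h <;> simp [h]

theorem of_mul_signSum {k : ℕ} (h : Equiv.Perm (Fin k)) :
    MonoidAlgebra.of ℂ (Equiv.Perm (Fin k)) h * signSum k =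
      ((Equiv.Perm.sign h : ℤ) : ℂ) • signSum k := by
  rw [signSum, Finset.mul_sum, Finset.smul_sum]
  refine Fintype.sum_equiv (Equiv.mulLeft h) _ _ fun g => ?_
  rw [Equiv.coe_mulLeft, mul_smul_comm, ← map_mul, smul_smul, Equiv.Perm.sign_mul,
    Units.val_mul, Int.cast_mul, ← mul_assoc, sign_mul_sign_complex, one_mul]

theorem signSum_mul_of {k : ℕ} (h : Equiv.Perm (Fin k)) :
    signSum k * MonoidAlgebra.of ℂ (Equiv.Perm (Fin k)) h =
      ((Equiv.Perm.sign h : ℤ) : ℂ) • signSum k := by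
  rw [signSum, Finset.sum_mul, Finset.smul_sum]
  refine Fintype.sum_equiv (Equiv.mulRight h) _ _ fun g => ?_
  rw [Equiv.coe_mulRight, smul_mul_assoc, ← map_mul, smul_smul, Equiv.Perm.sign_mul,
    Units.val_mul, Int.cast_mul, mul_left_comm, sign_mul_sign_complex, mul_one]

/-- The transposition of `i` and `j` can be inserted between the factors: the row symmetrizer
absorbs it, while the signed sum changes sign. The product is thus its own negative. -/
theorem signSum_mul_rowSymmetrizer {k : ℕ} (lam : k.Partition) {i j : Fin k} (hij : i ≠ j)
    (h : (partitionCell lam i).1 = (partitionCell lam j).1) :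
    signSum k * rowSymmetrizer lam = 0 := by
  have hrow : MonoidAlgebra.of ℂ (Equiv.Perm (Fin k)) (Equiv.swap i j) * rowSymmetrizer lam =
      rowSymmetrizer lam := by
    have hs : ∀ a, (partitionCell lam (Equiv.swap i j a)).1 = (partitionCell lam a).1 := by
      intro a
      rw [Equiv.swap_apply_def]
      split_ifs with h1 h2
      · rw [h1, h]
      · rw [h2, h]
      · rfl
    rw [rowSymmetrizer, Finset.mul_sum]
    refine Finset.sum_equiv (Equiv.mulLeft (Equiv.swap i j)) (fun g => ?_) fun g _ => ?_
    · simp only [Finset.mem_filter_univ, Equiv.coe_mulLeft, Equiv.Perm.mul_apply, hs]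
    · rw [Equiv.coe_mulLeft, map_mul]
  have h1 : signSum k * rowSymmetrizer lam = -(signSum k * rowSymmetrizer lam) := by
    conv_lhs => rw [← hrow, ← mul_assoc, signSum_mul_of, Equiv.Perm.sign_swap hij]
    simp
  have h2 : (2 : ℂ) • (signSum k * rowSymmetrizer lam) = 0 := by
    rw [two_smul]
    exact eq_neg_iff_add_eq_zero.mp h1
  exact (smul_eq_zero.mp h2).resolve_left two_ne_zero

theorem signSum_mul_specht {k : ℕ} (lam : k.Partition) {i j : Fin k} (hij : i ≠ j)
    (h : (partitionCell lam i).1 = (partitionCell lam j).1) (s : SpechtModule lam) :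
    signSum k * (s : MonoidAlgebra ℂ (Equiv.Perm (Fin k))) = 0 := by
  obtain ⟨b, hb⟩ := Submodule.mem_span_singleton.mp s.2
  rw [← hb, smul_eq_mul, ← mul_assoc b, ← mul_assoc]
  generalize b * columnAntisymmetrizer lam = c
  induction c using MonoidAlgebra.induction_on with
  | of g => rw [signSum_mul_of, smul_mul_assoc, signSum_mul_rowSymmetrizer lam hij h, smul_zero]
  | add a b ha hb => rw [mul_add, add_mul, ha, hb, add_zero]
  | smul r a ha => rw [mul_smul_comm, smul_mul_assoc, ha, smul_zero]

/-- If some part is not 1, the largest part, which comes first, is at least 2, and the entries 0 and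
1 share the first row. -/
theorem exists_same_row {k : ℕ} (hk : 1 ≤ k) (lam : k.Partition)
    (h : lam.parts ≠ Multiset.replicate k 1) :
    ∃ i j : Fin k, i ≠ j ∧ (partitionCell lam i).1 = (partitionCell lam j).1 := by
  have hsorted := lam.parts.pairwise_sort (· ≥ ·)
  have hsum : (lam.parts.sort (· ≥ ·)).sum = k := by
    rw [← Multiset.sum_coe, Multiset.sort_eq, lam.parts_sum]
  have hmem : ∀ a, a ∈ lam.parts.sort (· ≥ ·) ↔ a ∈ lam.parts := fun a => Multiset.mem_sort _
  unfold partitionCell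
  cases hL : lam.parts.sort (· ≥ ·) with
  | nil =>
    rw [hL, List.sum_nil] at hsum
    omega
  | cons a l =>
    rw [hL, List.pairwise_cons] at hsorted
    have ha : 2 ≤ a := by
      by_contra ha
      apply h
      have h1 : ∀ b ∈ lam.parts, b = 1 := by
        intro b hb
        have hpos := lam.parts_pos hb
        rw [← hmem, hL, List.mem_cons] at hb
        rcases hb with rfl | hb
        · omega
        · have := hsorted.1 b hb
          omega
      have h2 := Multiset.eq_replicate_card.mpr h1
      have h3 := lam.parts_sum
      rw [h2, Multiset.sum_replicate, smul_eq_mul, mul_one] at h3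
      rw [h2, h3]
    have hak : a ≤ k := by
      rw [← hsum, hL, List.sum_cons]
      exact Nat.le_add_right _ _
    refine ⟨⟨0, by omega⟩, ⟨1, by omega⟩, by simp, ?_⟩
    simp only [tableauCell]
    rw [if_pos (by omega), if_pos (by omega)]

theorem tableauCell_replicate_one (r i : ℕ) (hi : i < r) :
    tableauCell (List.replicate r 1) i = (i, 0) := by
  induction r generalizing i with
  | zero => omega
  | succ r ih =>
    rw [List.replicate_succ, tableauCell]
    split_ifs with h
    · rw [Nat.lt_one_iff.mp h]
    · rw [ih (i - 1) (by omega)]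
      simp only [Prod.mk.injEq, and_true]
      omega

theorem partitionCell_onesPartition (r : ℕ) (i : Fin r) :
    partitionCell (onesPartition r) i = ((i : ℕ), 0) := by
  have h : (onesPartition r).parts.sort (· ≥ ·) = List.replicate r 1 := by
    rw [List.eq_replicate_iff]
    constructor
    · rw [Multiset.length_sort]
      exact Multiset.card_replicate _ _
    · intro b hb
      exact Multiset.eq_of_mem_replicate ((Multiset.mem_sort _).mp hb)
  rw [partitionCell, h, tableauCell_replicate_one r i i.2]

theorem youngSymmetrizer_onesPartition (r : ℕ) :
    columnAntisymmetrizer (onesPartition r) * rowSymmetrizer (onesPartition r) = signSum r := by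
  have h1 : rowSymmetrizer (onesPartition r) = 1 := by
    rw [rowSymmetrizer, Finset.sum_eq_single (1 : Equiv.Perm (Fin r)), map_one]
    · intro g hg hne
      refine absurd (Equiv.ext fun i => Fin.ext ?_) hne
      simpa [partitionCell_onesPartition] using (Finset.mem_filter.mp hg).2 i
    · simp
  have h2 : columnAntisymmetrizer (onesPartition r) = signSum r := by
    simp only [columnAntisymmetrizer, partitionCell_onesPartition, signSum, implies_true,
      Finset.filter_true]
  rw [h1, h2, mul_one]

theorem coeff_signSum_one (r : ℕ) : (signSum r).coeff 1 = 1 := by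
  rw [signSum, MonoidAlgebra.coeff_sum, Finset.sum_apply', Finset.sum_eq_single 1]
  · simp
  · intro g _ hg
    rw [MonoidAlgebra.coeff_smul_apply, MonoidAlgebra.of_apply, MonoidAlgebra.coeff_single,
      Finsupp.single_eq_of_ne (Ne.symm hg), smul_zero]
  · simp

/-- The coefficient of the identity in an element of a Specht module. -/
def spechtCoeff {k : ℕ} (lam : k.Partition) : SpechtModule lam →ₗ[ℂ] ℂ where
  toFun s := (s : MonoidAlgebra ℂ (Equiv.Perm (Fin k))).coeff 1
  map_add' _ _ := rfl
  map_smul' _ _ := rfl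

/-- The generator of the sign module. -/
def signGen (r : ℕ) : SpechtModule (onesPartition r) :=
  ⟨signSum r, youngSymmetrizer_onesPartition r ▸ Submodule.mem_span_singleton_self _⟩

theorem spechtCoeff_signGen (r : ℕ) : spechtCoeff _ (signGen r) = 1 := coeff_signSum_one r

/-- Left multiplication only rescales the signed sum, so the module is a line; the coefficient at
the identity is its coordinate because the signed sum has coefficient 1 there. -/
theorem specht_onesPartition_eq_smul {r : ℕ} (s : SpechtModule (onesPartition r)) :
    s = spechtCoeff _ s • signGen r := by
  have h : ∃ a : ℂ, s = a • signGen r := by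
    obtain ⟨b, hb⟩ := Submodule.mem_span_singleton.mp s.2
    rw [youngSymmetrizer_onesPartition, smul_eq_mul] at hb
    have h2 : ∀ b : MonoidAlgebra ℂ (Equiv.Perm (Fin r)), ∃ a : ℂ, b * signSum r = a • signSum r := by
      intro b
      induction b using MonoidAlgebra.induction_on with
      | of g => exact ⟨_, of_mul_signSum g⟩
      | add a b ha hb =>
        obtain ⟨x, hx⟩ := ha
        obtain ⟨y, hy⟩ := hb
        exact ⟨x + y, by rw [add_mul, hx, hy, add_smul]⟩
      | smul r a ha =>
        obtain ⟨x, hx⟩ := ha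
        exact ⟨r * x, by rw [smul_mul_assoc, hx, smul_smul]⟩
    obtain ⟨a, ha⟩ := h2 b
    exact ⟨a, Subtype.ext (hb.symm.trans ha)⟩
  obtain ⟨a, rfl⟩ := h
  rw [map_smul, spechtCoeff_signGen, smul_eq_mul, mul_one]

theorem coe_spechtRep {k : ℕ} (lam : k.Partition) (g : Equiv.Perm (Fin k)) (s : SpechtModule lam) :
    (spechtRep lam g s : MonoidAlgebra ℂ (Equiv.Perm (Fin k))) =
      MonoidAlgebra.of ℂ (Equiv.Perm (Fin k)) g * s := rfl

theorem spechtRep_onesPartition {r : ℕ} (g : Equiv.Perm (Fin r))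
    (s : SpechtModule (onesPartition r)) :
    spechtRep _ g s = ((Equiv.Perm.sign g : ℤ) : ℂ) • s := by
  rw [specht_onesPartition_eq_smul s, map_smul, smul_comm]
  congr 1
  exact Subtype.ext ((coe_spechtRep _ g _).trans (of_mul_signSum g))

theorem sum_sign_smul_spechtRep {k : ℕ} (lam : k.Partition) {i j : Fin k} (hij : i ≠ j)
    (h : (partitionCell lam i).1 = (partitionCell lam j).1) (s : SpechtModule lam) :
    ∑ g, ((Equiv.Perm.sign g : ℤ) : ℂ) • spechtRep lam g s = 0 := by
  apply Subtype.ext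
  rw [ZeroMemClass.coe_zero, ← signSum_mul_specht lam hij h s, signSum, Finset.sum_mul,
    AddSubmonoidClass.coe_finsetSum]
  refine Finset.sum_congr rfl fun g _ => ?_
  rw [smul_mul_assoc, ← coe_spechtRep]
  rfl

/-! ### Induced modules for a general monoid -/

section Induced

variable {M : Type} [Monoid M] {e : M} (he : IsIdempotentElem e)
  {V : Type} [AddCommGroup V] [Module ℂ V] (ρ : Representation ℂ (MaximalSubgroup he) V)

/-- The class of `ℓ ⊗ v` in the induced module. -/
def indMk (l : LClass e) : V →+ IndModule he ρ where
  toFun v := (indRelations he ρ).mkQ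
    ((schutzenberger ℂ e).asModuleEquiv.symm (SchutzenbergerSpace.basis ℂ e l) ⊗ₜ[ℂ] v)
  map_zero' := by rw [TensorProduct.tmul_zero, map_zero]
  map_add' v w := by rw [TensorProduct.tmul_add, map_add]

theorem indMk_smul (l : LClass e) (a : ℂ) (v : V) :
    indMk he ρ l (a • v) = algebraMap ℂ (MonoidAlgebra ℂ M) a • indMk he ρ l v := by
  change (indRelations he ρ).mkQ _ = _ • (indRelations he ρ).mkQ _
  rw [← map_smul, algebraMap_smul, TensorProduct.tmul_smul]

theorem indMk_rightMul (l : LClass e) (g : MaximalSubgroup he) (v : V) :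
    indMk he ρ (LClass.rightMul l g) v = indMk he ρ l (ρ g v) := by
  refine (Submodule.Quotient.eq _).mpr (Submodule.subset_span ⟨l, g, v, rfl⟩)

theorem of_smul_tmul (f : M) (x : SchutzenbergerSpace ℂ e) (v : V) :
    MonoidAlgebra.of ℂ M f • ((schutzenberger ℂ e).asModuleEquiv.symm x ⊗ₜ[ℂ] v) =
      (schutzenberger ℂ e).asModuleEquiv.symm (schutzenbergerMap ℂ e f x) ⊗ₜ[ℂ] v := by
  rw [TensorProduct.smul_tmul', ← Representation.asModuleEquiv_symm_map_rho]
  rfl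

theorem of_smul_indMk (f : M) (l : LClass e) (v : V) (h : f * (l : M) ∈ LClass e) :
    MonoidAlgebra.of ℂ M f • indMk he ρ l v = indMk he ρ ⟨f * l, h⟩ v := by
  change _ • (indRelations he ρ).mkQ _ = (indRelations he ρ).mkQ _
  rw [← map_smul, of_smul_tmul, schutzenbergerMap_basis_of_mem]

theorem of_smul_indMk_of_notMem (f : M) (l : LClass e) (v : V) (h : f * (l : M) ∉ LClass e) :
    MonoidAlgebra.of ℂ M f • indMk he ρ l v = 0 := by
  change _ • (indRelations he ρ).mkQ _ = _
  rw [← map_smul, of_smul_tmul, schutzenbergerMap_basis_of_notMem _ _ _ _ h, map_zero,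
    TensorProduct.zero_tmul, map_zero]

theorem ind_induction {p : IndModule he ρ → Prop} (h0 : p 0) (hmk : ∀ l v, p (indMk he ρ l v))
    (hadd : ∀ x y, p x → p y → p (x + y)) (w : IndModule he ρ) : p w := by
  obtain ⟨t, rfl⟩ := (indRelations he ρ).mkQ_surjective w
  induction t using TensorProduct.induction_on with
  | zero => rwa [map_zero]
  | add x y hx hy => rw [map_add]; exact hadd _ _ hx hy
  | tmul x v =>
    obtain ⟨x, rfl⟩ := (schutzenberger ℂ e).asModuleEquiv.symm.surjective x
    induction (SchutzenbergerSpace.basis ℂ e).mem_span x using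
      Submodule.span_induction generalizing v with
    | mem x hx =>
      obtain ⟨l, rfl⟩ := hx
      exact hmk l v
    | zero => rwa [map_zero, TensorProduct.zero_tmul, map_zero]
    | add x y _ _ hx hy =>
      rw [map_add, TensorProduct.add_tmul, map_add]
      exact hadd _ _ (hx v) (hy v)
    | smul a x _ hx =>
      rw [map_smul, TensorProduct.smul_tmul]
      exact hx (a • v)

theorem self_mem_LClass (e : M) : e ∈ LClass e := rfl

/-- In a finite monoid, every element of `e Ind(V)` has the form `e ⊗ v`. -/
theorem idem_smul_ind [Finite M] (w : IndModule he ρ) :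
    ∃ v, MonoidAlgebra.of ℂ M e • w = indMk he ρ ⟨e, self_mem_LClass e⟩ v := by
  refine ind_induction he ρ (p := fun w => ∃ v, MonoidAlgebra.of ℂ M e • w =
    indMk he ρ ⟨e, self_mem_LClass e⟩ v) ⟨0, by rw [smul_zero, map_zero]⟩ (fun l v => ?_) ?_ w
  · by_cases h : e * (l : M) ∈ LClass e
    · obtain ⟨⟨a, ha⟩, ⟨b, hb⟩⟩ := mem_LClass_iff.mp h
      have hle : e * (l : M) * e = e * (l : M) := by rw [← hb, mul_assoc, he.eq]
      have hel : e * (e * (l : M)) = e * (l : M) := by rw [← mul_assoc, he.eq]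
      let x : LocalMonoid he := ⟨e * (l : M), (Subsemigroup.mem_corner_iff he).mpr ⟨hel, hle⟩⟩
      let y : LocalMonoid he := ⟨e * a * e, (Subsemigroup.mem_corner_iff he).mpr
        ⟨by simp only [← mul_assoc, he.eq], by simp only [mul_assoc, he.eq]⟩⟩
      have : Finite (LocalMonoid he) := inferInstanceAs (Finite (Subsemigroup.corner e))
      -- A one-sided inverse in the finite monoid eMe is two-sided, so `x` is a unit and can be
      -- moved across the tensor sign onto `v`.
      have hyx : y * x = 1 := by
        apply Subtype.ext
        change e * a * e * (e * (l : M)) = e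
        rw [mul_assoc, hel, mul_assoc, ha, he.eq]
      let g : MaximalSubgroup he := ⟨x, y, mul_eq_one_symm hyx, hyx⟩
      refine ⟨ρ g v, ?_⟩
      rw [of_smul_indMk he ρ e l v h, ← indMk_rightMul]
      exact congrArg (fun l => indMk he ρ l v) (Subtype.ext hel.symm)
    · exact ⟨0, by rw [of_smul_indMk_of_notMem he ρ e l v h, map_zero]⟩
  · rintro x y ⟨v, hv⟩ ⟨w, hw⟩
    exact ⟨v + w, by rw [smul_add, hv, hw, map_add]⟩

/-- Passing to the quotient by N_e leaves no further vectors annihilated by e𝕜M: if e f w lies in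
N_e, then e f w = e(e f w) = 0. -/
theorem simpleLift_eq_zero (y : SimpleLift he ρ)
    (h : ∀ f : M, MonoidAlgebra.of ℂ M e • MonoidAlgebra.of ℂ M f • y = 0) : y = 0 := by
  obtain ⟨w, rfl⟩ := (annSubmodule ℂ e (IndModule he ρ)).mkQ_surjective y
  refine (Submodule.Quotient.mk_eq_zero _).mpr ((mem_annSubmodule_iff w).mpr fun f => ?_)
  have h1 := h f
  rw [← map_smul, ← map_smul, Submodule.mkQ_apply, Submodule.Quotient.mk_eq_zero,
    mem_annSubmodule_iff] at h1
  have h2 := h1 1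
  rwa [map_one, one_smul, smul_smul, ← map_mul, he.eq] at h2

variable {X : Type} [AddCommGroup X] [Module ℂ X] [Module (MonoidAlgebra ℂ M) X]
  [IsScalarTower ℂ (MonoidAlgebra ℂ M) X]

/-- A bilinear pairing compatible with the action of the monoid, as a map of a tensor product. -/
def tensorLift (B : SchutzenbergerSpace ℂ e →ₗ[ℂ] V →ₗ[ℂ] X)
    (hB : ∀ f x v, B (schutzenbergerMap ℂ e f x) v = MonoidAlgebra.of ℂ M f • B x v) :
    ((schutzenberger ℂ e).asModule ⊗[ℂ] V) →ₗ[MonoidAlgebra ℂ M] X :=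
  MonoidAlgebra.equivariantOfLinearOfComm
    (TensorProduct.lift (B ∘ₗ (schutzenberger ℂ e).asModuleEquiv.toLinearMap)) fun f t => by
    induction t using TensorProduct.induction_on with
    | zero => simp only [smul_zero, map_zero]
    | add x y hx hy => simp only [smul_add, map_add, hx, hy]
    | tmul x v =>
      obtain ⟨x, rfl⟩ := (schutzenberger ℂ e).asModuleEquiv.symm.surjective x
      have h := of_smul_tmul f x v
      rw [MonoidAlgebra.of_apply] at h
      rw [h]
      exact hB f x v

theorem tensorLift_tmul (B : SchutzenbergerSpace ℂ e →ₗ[ℂ] V →ₗ[ℂ] X)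
    (hB : ∀ f x v, B (schutzenbergerMap ℂ e f x) v = MonoidAlgebra.of ℂ M f • B x v)
    (x : SchutzenbergerSpace ℂ e) (v : V) :
    tensorLift B hB ((schutzenberger ℂ e).asModuleEquiv.symm x ⊗ₜ[ℂ] v) = B x v := rfl

/-- The map of the induced module given by a balanced pairing. -/
def indLift (B : SchutzenbergerSpace ℂ e →ₗ[ℂ] V →ₗ[ℂ] X)
    (hB : ∀ f x v, B (schutzenbergerMap ℂ e f x) v = MonoidAlgebra.of ℂ M f • B x v)
    (hbal : ∀ l g v, B (SchutzenbergerSpace.basis ℂ e (LClass.rightMul l g)) v =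
      B (SchutzenbergerSpace.basis ℂ e l) (ρ g v)) :
    IndModule he ρ →ₗ[MonoidAlgebra ℂ M] X :=
  (indRelations he ρ).liftQ (tensorLift B hB) <| by
    rw [indRelations, Submodule.span_le]
    rintro _ ⟨l, g, v, rfl⟩
    rw [SetLike.mem_coe, LinearMap.mem_ker, map_sub, sub_eq_zero, tensorLift_tmul,
      tensorLift_tmul, hbal]

end Induced

/-! ### Morphisms from forms to the simple modules of 𝔗_n -/

section FullTransformation

variable {n k : ℕ} (hk : 1 ≤ k) (hkn : k ≤ n)

instance (n : ℕ) : Finite (FullTransformation n) := inferInstanceAs (Finite (Fin n → Fin n))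

/-- The induced module of a Specht module. -/
abbrev spechtInd (lam : k.Partition) : Type :=
  IndModule (stdIdem_isIdempotent (n := n) hk) ((spechtRep lam).comp (restrictPerm hk hkn))

/-- The element of the maximal subgroup at `e_k` that restricts to a given permutation. -/
def extendPerm (σ : Equiv.Perm (Fin k)) : MaximalSubgroup (stdIdem_isIdempotent (n := n) hk) :=
  have hl : ∀ τ : Equiv.Perm (Fin k),
      stdIdem n k * extendMap hk (Fin.castLE hkn ∘ τ) = extendMap hk (Fin.castLE hkn ∘ τ) := by
    intro τ
    rw [mul_extendMap]
    congr 1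
    funext i
    exact stdIdem_of_lt _ (τ i).2
  have hr : ∀ τ : Equiv.Perm (Fin k),
      extendMap hk (Fin.castLE hkn ∘ τ) * stdIdem n k = extendMap hk (Fin.castLE hkn ∘ τ) := by
    intro τ
    rw [← extendMap_comp_castLE hk hkn]
    congr 1
    funext i
    exact extendMap_castLE hk hkn _ i
  have hmul : ∀ τ τ' : Equiv.Perm (Fin k), τ * τ' = 1 →
      extendMap hk (Fin.castLE hkn ∘ τ) * extendMap hk (Fin.castLE hkn ∘ τ') = stdIdem n k := by
    intro τ τ' h
    rw [mul_extendMap, ← one_mul (stdIdem n k), ← extendMap_comp_castLE hk hkn]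
    congr 1
    funext i
    refine (extendMap_castLE hk hkn _ (τ' i)).trans ?_
    have := Equiv.congr_fun h i
    exact congrArg (Fin.castLE hkn) this
  { val := ⟨extendMap hk (Fin.castLE hkn ∘ σ),
      (Subsemigroup.mem_corner_iff (stdIdem_isIdempotent hk)).mpr ⟨hl σ, hr σ⟩⟩
    inv := ⟨extendMap hk (Fin.castLE hkn ∘ (σ⁻¹ : Equiv.Perm (Fin k))),
      (Subsemigroup.mem_corner_iff (stdIdem_isIdempotent hk)).mpr ⟨hl _, hr _⟩⟩
    val_inv := Subtype.ext (hmul _ _ (mul_inv_cancel σ))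
    inv_val := Subtype.ext (hmul _ _ (inv_mul_cancel σ)) }

theorem restrictPerm_apply (g : MaximalSubgroup (stdIdem_isIdempotent (n := n) hk)) (i : Fin k) :
    (g : LocalMonoid (stdIdem_isIdempotent (n := n) hk)).val (Fin.castLE hkn i) =
      Fin.castLE hkn (restrictPerm hk hkn g i) := rfl

theorem extendPerm_apply (σ : Equiv.Perm (Fin k)) (i : Fin k) :
    (extendPerm hk hkn σ : LocalMonoid (stdIdem_isIdempotent (n := n) hk)).val (Fin.castLE hkn i) =
      Fin.castLE hkn (σ i) := extendMap_castLE hk hkn _ i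

theorem restrictPerm_extendPerm (σ : Equiv.Perm (Fin k)) :
    restrictPerm hk hkn (extendPerm hk hkn σ) = σ := by
  refine Equiv.ext fun i => Fin.castLE_injective hkn ?_
  rw [← restrictPerm_apply, extendPerm_apply]

theorem injective_of_mem_LClass {l : FullTransformation n} (hl : l ∈ LClass (stdIdem n k)) :
    Function.Injective fun i : Fin k => l (Fin.castLE hkn i) := by
  obtain ⟨⟨a, ha⟩, -⟩ := mem_LClass_iff.mp hl
  have h : ∀ i : Fin k, a (l (Fin.castLE hkn i)) = Fin.castLE hkn i := fun i =>
    (congrFun ha _).trans (stdIdem_of_lt _ i.2)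
  intro i j hij
  apply Fin.castLE_injective hkn
  rw [← h i, ← h j]
  exact congrArg a hij

theorem not_injective_stdIdem_mul {r : ℕ} (hr : 1 ≤ r) (hrk : r < k) (f : FullTransformation n) :
    ¬ Function.Injective fun i : Fin k => (stdIdem n r * f) (Fin.castLE hkn i) := by
  intro h
  let F : Fin k → Fin r := fun i => ⟨(stdIdem n r * f) (Fin.castLE hkn i), stdIdem_lt hr _⟩
  have hF : Function.Injective F := fun i j hij =>
    h (Fin.ext (Fin.mk.inj_iff.mp hij))
  have := Fintype.card_le_of_injective F hF
  simp only [Fintype.card_fin] at this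
  omega

theorem mem_LClass_of_injective (hk : 1 ≤ k) (l : FullTransformation n) (hle : l * stdIdem n k = l)
    (h : Function.Injective fun i : Fin k => l (Fin.castLE hkn i)) : l ∈ LClass (stdIdem n k) := by
  refine mem_LClass_iff.mpr ⟨?_, l, hle⟩
  have : Nonempty (Fin k) := ⟨⟨0, hk⟩⟩
  -- The default values of `invFun` do not matter: since l = l e_k, every value of `l` is already
  -- taken on [k].
  refine ⟨fun j => Fin.castLE hkn (Function.invFun (fun i : Fin k => l (Fin.castLE hkn i)) j), ?_⟩
  funext i
  have hi : l i = l (Fin.castLE hkn ⟨stdIdem n k i, stdIdem_lt hk i⟩) := congrFun hle.symm i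
  change Fin.castLE hkn (Function.invFun _ (l i)) = stdIdem n k i
  rw [hi]
  exact congrArg (Fin.castLE hkn) (Function.leftInverse_invFun h ⟨stdIdem n k i, stdIdem_lt hk i⟩)

/-- Elements of L_{e_k} are injective on [k], and this is lost after composing with a map of rank at
most r < k. -/
theorem stdIdem_smul_ind_of_lt {r : ℕ} (hr : 1 ≤ r) (hrk : r < k) (lam : k.Partition)
    (w : spechtInd (n := n) hk hkn lam) :
    MonoidAlgebra.of ℂ (FullTransformation n) (stdIdem n r) • w = 0 := by
  refine ind_induction _ _
    (p := fun w => MonoidAlgebra.of ℂ (FullTransformation n) (stdIdem n r) • w = 0)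
    (smul_zero _) (fun l v => ?_) (fun x y hx hy => by rw [smul_add, hx, hy, add_zero]) w
  exact of_smul_indMk_of_notMem _ _ _ _ _ fun h =>
    not_injective_stdIdem_mul hkn hr hrk (l : FullTransformation n) (injective_of_mem_LClass hkn h)

/-- A unit g of e𝔗_n e satisfies g e = e g, so its left action on e ⊗ s passes through the tensor
sign to s. -/
theorem extendPerm_smul_indMk (lam : k.Partition) (σ : Equiv.Perm (Fin k)) (s : SpechtModule lam) :
    MonoidAlgebra.of ℂ (FullTransformation n)
        (extendPerm hk hkn σ : LocalMonoid (stdIdem_isIdempotent (n := n) hk)).val •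
      indMk (stdIdem_isIdempotent (n := n) hk) ((spechtRep lam).comp (restrictPerm hk hkn))
        ⟨stdIdem n k, self_mem_LClass _⟩ s =
      indMk (stdIdem_isIdempotent (n := n) hk) ((spechtRep lam).comp (restrictPerm hk hkn))
        ⟨stdIdem n k, self_mem_LClass _⟩ (spechtRep lam σ s) := by
  have h := indMk_rightMul (stdIdem_isIdempotent (n := n) hk)
    ((spechtRep lam).comp (restrictPerm hk hkn)) ⟨stdIdem n k, self_mem_LClass _⟩
    (extendPerm hk hkn σ) s
  rw [MonoidHom.comp_apply, restrictPerm_extendPerm] at h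
  rw [← h]
  have he : (extendPerm hk hkn σ : LocalMonoid (stdIdem_isIdempotent (n := n) hk)).val *
      stdIdem n k = stdIdem n k *
      (extendPerm hk hkn σ : LocalMonoid (stdIdem_isIdempotent (n := n) hk)).val := by
    rw [LocalMonoid.left_id, LocalMonoid.right_id]
  have hmem := (LClass.rightMul ⟨stdIdem n k, self_mem_LClass _⟩ (extendPerm hk hkn σ)).2
  rw [of_smul_indMk _ _ _ _ _ (he ▸ hmem)]
  exact congrArg (fun l => indMk _ _ l s) (Subtype.ext he)

/-- The modules of forms have no nonzero morphisms to simple modules other than those of the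
corresponding sign modules. -/
theorem hom_simpleLift_eq_zero {r : ℕ} (hr : 1 ≤ r) (hrn : r ≤ n) (lam : k.Partition)
    (h : r = k → lam.parts ≠ Multiset.replicate k 1)
    (φ : AltModule n r →ₗ[MonoidAlgebra ℂ (FullTransformation n)]
      SimpleLift (stdIdem_isIdempotent (n := n) hk)
        ((spechtRep lam).comp (restrictPerm hk hkn))) : φ = 0 := by
  refine altModule_hom_eq_zero hr hrn φ ?_
  rcases lt_trichotomy r k with hrk | rfl | hkr
  -- For r < k, the generator is fixed by e_r, which annihilates the target.
  · obtain ⟨w, hw⟩ := (annSubmodule ℂ (stdIdem n k) _).mkQ_surjective (φ (altGen hrn))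
    rw [← stdIdem_smul_altGen hrn, map_smul, ← hw, ← map_smul,
      stdIdem_smul_ind_of_lt hk hkn hr hrk, map_zero]
  · obtain ⟨i, j, hij, hrow⟩ := exists_same_row hk lam (h rfl)
    obtain ⟨w, hw⟩ := (annSubmodule ℂ (stdIdem n r) _).mkQ_surjective (φ (altGen hrn))
    obtain ⟨s, hs⟩ := idem_smul_ind _ _ w
    have hy : φ (altGen hrn) = (annSubmodule ℂ (stdIdem n r) _).mkQ (indMk
        (stdIdem_isIdempotent (n := n) hk) ((spechtRep lam).comp (restrictPerm hk hkn))
          ⟨stdIdem n r, self_mem_LClass _⟩ s) := by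
      rw [← stdIdem_smul_altGen hrn, map_smul, ← hw, ← map_smul, hs]
    -- Each σ acts on the image of the generator by its sign, so all signed translates of e ⊗ s have
    -- that same image. Summing them gives r! times the image, while the signed sum kills the Specht
    -- module.
    have hσ : ∀ σ : Equiv.Perm (Fin r), (annSubmodule ℂ (stdIdem n r) _).mkQ (indMk
        (stdIdem_isIdempotent (n := n) hk) ((spechtRep lam).comp (restrictPerm hk hkn))
          ⟨stdIdem n r, self_mem_LClass _⟩ (((Equiv.Perm.sign σ : ℤ) : ℂ) • spechtRep lam σ s)) =
        φ (altGen hrn) := by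
      intro σ
      rw [indMk_smul, map_smul, ← extendPerm_smul_indMk hk hkn, map_smul, ← hy, ← map_smul,
        of_smul_altGen_perm hrn _ σ (extendPerm_apply hk hkn σ), ← map_smul, algebraMap_smul,
        smul_smul, sign_mul_sign_complex, one_smul]
    have hsum := Finset.sum_congr (rfl : (Finset.univ : Finset (Equiv.Perm (Fin r))) = _)
      fun σ _ => hσ σ
    rw [← map_sum, ← map_sum, sum_sign_smul_spechtRep lam hij hrow, map_zero, map_zero,
      Finset.sum_const] at hsum
    have hr0 : ((Finset.univ : Finset (Equiv.Perm (Fin r))).card : ℂ) ≠ 0 := by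
      rw [Finset.card_univ, Fintype.card_perm]
      exact Nat.cast_ne_zero.mpr (Nat.factorial_ne_zero _)
    rw [← Nat.cast_smul_eq_nsmul ℂ] at hsum
    exact (smul_eq_zero.mp hsum.symm).resolve_left hr0
  -- For r > k, the map e_k f is not injective on [r] and so kills the generator.
  · refine simpleLift_eq_zero _ _ _ fun f => ?_
    rw [← mul_smul, ← map_mul, ← map_smul,
      of_smul_altGen_eq_zero hrn _ (not_injective_stdIdem_mul hrn hk hkr f), map_zero]

end FullTransformation

/-! ### The simple module of the sign representation as a Koszul image -/

section SignModule

variable {n r : ℕ} (hr : 1 ≤ r) (hrn : r ≤ n)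

/-- The bilinear map `(ℓ, s) ↦ s(1) ℓ u`, `u` being the generator of the module of forms. -/
def signPairing : SchutzenbergerSpace ℂ (stdIdem n r) →ₗ[ℂ]
    SpechtModule (onesPartition r) →ₗ[ℂ] AltModule n r :=
  (SchutzenbergerSpace.basis ℂ (stdIdem n r)).constr ℂ fun l =>
    (spechtCoeff (onesPartition r)).smulRight
      (MonoidAlgebra.of ℂ (FullTransformation n) l • altGen hrn)

theorem signPairing_basis (l : LClass (stdIdem n r)) (s : SpechtModule (onesPartition r)) :
    signPairing hrn (SchutzenbergerSpace.basis ℂ (stdIdem n r) l) s =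
      spechtCoeff _ s • MonoidAlgebra.of ℂ (FullTransformation n) l • altGen hrn := by
  rw [signPairing, Module.Basis.constr_basis, LinearMap.smulRight_apply]

/-- The zero in the Schützenberger action is matched by the determinant: if fℓ leaves L_{e_r}, it is
not injective on [r], and two columns coincide. -/
theorem signPairing_schutzenbergerMap (hr : 1 ≤ r) (f : FullTransformation n)
    (x : SchutzenbergerSpace ℂ (stdIdem n r)) (s : SpechtModule (onesPartition r)) :
    signPairing hrn (schutzenbergerMap ℂ (stdIdem n r) f x) s =
      MonoidAlgebra.of ℂ (FullTransformation n) f • signPairing hrn x s := by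
  induction (SchutzenbergerSpace.basis ℂ (stdIdem n r)).mem_span x using
    Submodule.span_induction with
  | mem x hx =>
    obtain ⟨l, rfl⟩ := hx
    rw [signPairing_basis, smul_comm, ← mul_smul (MonoidAlgebra.of _ _ f), ← map_mul]
    by_cases h : f * (l : FullTransformation n) ∈ LClass (stdIdem n r)
    · rw [schutzenbergerMap_basis_of_mem _ _ _ _ h, signPairing_basis]
    · rw [schutzenbergerMap_basis_of_notMem _ _ _ _ h, map_zero, LinearMap.zero_apply,
        of_smul_altGen_eq_zero hrn, smul_zero]
      refine fun hinj => h (mem_LClass_of_injective hrn hr _ ?_ hinj)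
      obtain ⟨-, b, hb⟩ := mem_LClass_iff.mp l.2
      rw [mul_assoc, ← hb, mul_assoc, (stdIdem_isIdempotent hr).eq]
  | zero => simp only [map_zero, LinearMap.zero_apply, smul_zero]
  | add x y _ _ hx hy => simp only [map_add, LinearMap.add_apply, smul_add, hx, hy]
  | smul a x _ hx => simp only [map_smul, LinearMap.smul_apply, hx, smul_comm a]

theorem signPairing_rightMul (l : LClass (stdIdem n r))
    (g : MaximalSubgroup (stdIdem_isIdempotent (n := n) hr)) (s : SpechtModule (onesPartition r)) :
    signPairing hrn (SchutzenbergerSpace.basis ℂ (stdIdem n r) (LClass.rightMul l g)) s =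
      signPairing hrn (SchutzenbergerSpace.basis ℂ (stdIdem n r) l)
        ((spechtRep (onesPartition r)).comp (restrictPerm hr hrn) g s) := by
  have hg : MonoidAlgebra.of ℂ (FullTransformation n) (LClass.rightMul l g) • altGen hrn =
      ((Equiv.Perm.sign (restrictPerm hr hrn g) : ℤ) : ℂ) •
        MonoidAlgebra.of ℂ (FullTransformation n) l • altGen hrn := by
    rw [LClass.rightMul, map_mul, mul_smul,
      of_smul_altGen_perm hrn _ _ (restrictPerm_apply hr hrn g), smul_comm]
  rw [signPairing_basis, signPairing_basis, hg, MonoidHom.comp_apply, spechtRep_onesPartition,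
    map_smul, smul_eq_mul, mul_smul, smul_comm]

/-- The map of the induced module to the module of forms. -/
def signIndMap :
    spechtInd (n := n) hr hrn (onesPartition r) →ₗ[MonoidAlgebra ℂ (FullTransformation n)]
      AltModule n r :=
  indLift _ _ (signPairing hrn) (signPairing_schutzenbergerMap hrn hr)
    (signPairing_rightMul hr hrn)

theorem signIndMap_indMk (l : LClass (stdIdem n r)) (s : SpechtModule (onesPartition r)) :
    signIndMap hr hrn (indMk _ _ l s) =
      spechtCoeff _ s • MonoidAlgebra.of ℂ (FullTransformation n) l • altGen hrn :=
  signPairing_basis hrn l s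

theorem signIndMap_surjective : Function.Surjective (signIndMap (n := n) hr hrn) := by
  intro c
  refine ⟨altSection hr c • indMk _ _ ⟨stdIdem n r, self_mem_LClass _⟩ (signGen r), ?_⟩
  rw [map_smul, signIndMap_indMk, spechtCoeff_signGen, one_smul, stdIdem_smul_altGen,
    altSection_smul_altGen]

/-- On e_r Ind, which consists of the elements e_r ⊗ s with s on the sign line, the map to forms is
injective because the generator is nonzero. Injectivity on this part suffices to compare the
annihilated submodules. -/
theorem stdIdem_smul_eq_zero_of_signIndMap (w : spechtInd (n := n) hr hrn (onesPartition r))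
    (h : MonoidAlgebra.of ℂ (FullTransformation n) (stdIdem n r) • signIndMap hr hrn w = 0) :
    MonoidAlgebra.of ℂ (FullTransformation n) (stdIdem n r) • w = 0 := by
  obtain ⟨s, hs⟩ := idem_smul_ind _ _ w
  rw [← map_smul, hs, signIndMap_indMk, stdIdem_smul_altGen] at h
  have h1 := (smul_eq_zero.mp h).resolve_right (altGen_ne_zero hr hrn)
  rw [hs, specht_onesPartition_eq_smul s, h1, zero_smul, map_zero]

theorem annSubmodule_spechtInd :
    annSubmodule ℂ (stdIdem n r) (spechtInd (n := n) hr hrn (onesPartition r)) =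
      (annSubmodule ℂ (stdIdem n r) (AltModule n r)).comap (signIndMap hr hrn) := by
  ext w
  rw [Submodule.mem_comap, mem_annSubmodule_iff, mem_annSubmodule_iff]
  refine forall_congr' fun f => ⟨fun h => ?_, fun h => ?_⟩
  · rw [← map_smul, ← map_smul, h, map_zero]
  · refine stdIdem_smul_eq_zero_of_signIndMap hr hrn _ ?_
    rwa [map_smul]

/-- The simple module of the sign module is the image of the Koszul differential. -/
def simpleLiftEquivRange {q : ℕ} (hr : 1 ≤ q + 1) (hn : q + 1 ≤ n) :
    SimpleLift (stdIdem_isIdempotent (n := n) hr)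
        ((spechtRep (onesPartition (q + 1))).comp (restrictPerm hr hn))
      ≃ₗ[MonoidAlgebra ℂ (FullTransformation n)] LinearMap.range (koszulMap n q) :=
  -- The submodule divided out is the preimage of the kernel of the Koszul differential, hence the
  -- kernel of the composite from the induced module.
  (Submodule.quotEquivOfEq _ _ (by
    rw [annSubmodule_spechtInd, ← ker_koszulMap_eq_annSubmodule hn, ← LinearMap.ker_comp])).trans
    (((koszulMap n q) ∘ₗ signIndMap hr hn).quotKerEquivRange.trans (LinearEquiv.ofEq _ _
      (LinearMap.range_comp_of_range_eq_top _
        (LinearMap.range_eq_top.mpr (signIndMap_surjective hr hn)))))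

end SignModule

/-! ### The Koszul resolution and the extension groups -/

open CategoryTheory

/-- The syzygies of the Koszul resolution. -/
def koszulSyzygy (n q : ℕ) : ModuleCat.{0} (MonoidAlgebra ℂ (FullTransformation n)) :=
  ModuleCat.of _ (LinearMap.range (koszulMap n q))

/-- The terms of the Koszul resolution. -/
def koszulTerm (n q : ℕ) : ModuleCat.{0} (MonoidAlgebra ℂ (FullTransformation n)) :=
  ModuleCat.of _ (AltModule n (q + 1))

instance (n q : ℕ) : Projective (koszulTerm n q) := by
  have := altModule_projective (n := n) (Nat.le_add_left 1 q)
  exact (IsProjective.iff_projective _).mp this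

/-- The inclusion of a syzygy. -/
def koszulInclusion (n q : ℕ) : koszulSyzygy n (q + 1) ⟶ koszulTerm n q :=
  ModuleCat.ofHom (LinearMap.range (koszulMap n (q + 1))).subtype

/-- The projection of a term onto its syzygy. -/
def koszulProjection (n q : ℕ) : koszulTerm n q ⟶ koszulSyzygy n q :=
  ModuleCat.ofHom (koszulMap n q).rangeRestrict

theorem koszulInclusion_comp_projection (n q : ℕ) :
    koszulInclusion n q ≫ koszulProjection n q = 0 := by
  refine ModuleCat.hom_ext (LinearMap.ext fun (x : LinearMap.range (koszulMap n (q + 1))) => ?_)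
  have hx : (x : AltModule n (q + 1)) ∈ LinearMap.ker (koszulMap n q) := by
    rw [ker_koszulMap]
    exact x.2
  exact Subtype.ext hx

theorem koszul_shortExact (n q : ℕ) :
    (ShortComplex.mk _ _ (koszulInclusion_comp_projection n q)).ShortExact where
  exact := by
    rw [ShortComplex.moduleCat_exact_iff]
    intro x hx
    have hx' : x ∈ LinearMap.ker (koszulMap n q) := congrArg Subtype.val hx
    rw [ker_koszulMap] at hx'
    exact ⟨⟨x, hx'⟩, rfl⟩
  mono_f := (ModuleCat.mono_iff_injective _).mpr Subtype.val_injective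
  epi_g := (ModuleCat.epi_iff_surjective _).mpr (koszulMap n q).surjective_rangeRestrict

/-- The simple module of the sign module of `𝔖_{q+1}` is a syzygy of the Koszul resolution. -/
def simpleModuleIso {n q : ℕ} (hr : 1 ≤ q + 1) (hn : q + 1 ≤ n) :
    simpleModuleL hr hn (onesPartition (q + 1)) ≅ koszulSyzygy n q :=
  (simpleLiftEquivRange hr hn).toModuleIso

theorem koszulTerm_hom_eq_zero {n k q : ℕ} (hk : 1 ≤ k) (hkn : k ≤ n) (lam : k.Partition)
    (h : q + 1 = k → lam.parts ≠ Multiset.replicate k 1)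
    (φ : koszulTerm n q ⟶ simpleModuleL hk hkn lam) : φ = 0 := by
  rcases le_or_gt (q + 1) n with hn | hn
  · ext1
    exact hom_simpleLift_eq_zero hk hkn (Nat.le_add_left 1 q) hn lam h φ.hom
  -- Beyond degree n the resolution consists of zero modules.
  · have := altModule_subsingleton hn
    ext x
    have hx : x = 0 := Subsingleton.elim (α := AltModule n (q + 1)) _ _
    rw [hx, map_zero, map_zero]

theorem koszulTerm_hom_eq_smul {n q : ℕ} (hn : q + 1 ≤ n)
    (φ : koszulTerm n q ⟶ koszulSyzygy n q) : ∃ a : ℂ, φ = a • koszulProjection n q := by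
  obtain ⟨a, ha⟩ := hom_range_koszulMap hn φ.hom
  refine ⟨a, ?_⟩
  ext x
  exact ha x

theorem koszulProjection_ne_zero {n q : ℕ} (hn : q + 1 ≤ n) : koszulProjection n q ≠ 0 := by
  intro h
  apply koszulMap_altGen_ne_zero hn
  have h1 := ConcreteCategory.congr_hom h (altGen hn)
  exact congrArg Subtype.val h1

theorem nonempty_hom_linearEquiv {n q : ℕ} (hr : 1 ≤ q + 1) (hn : q + 1 ≤ n) :
    Nonempty ((koszulTerm n q ⟶ simpleModuleL hr hn (onesPartition (q + 1))) ≃ₗ[ℂ] ℂ) := by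
  refine ⟨((Linear.homCongr ℂ (Iso.refl _) (simpleModuleIso hr hn)).trans
    (LinearEquiv.ofBijective (LinearMap.toSpanSingleton ℂ _ (koszulProjection n q))
      ⟨?_, ?_⟩).symm)⟩
  · exact smul_left_injective ℂ (koszulProjection_ne_zero hn)
  · intro φ
    obtain ⟨a, rfl⟩ := koszulTerm_hom_eq_smul hn φ
    exact ⟨a, rfl⟩

/-- Minimality of the resolution: a morphism to L(λ) is either zero or, when λ = (1^{q+1}), a
multiple of the projection, whose kernel is the syzygy. -/
theorem koszulInclusion_comp {n k : ℕ} (hk : 1 ≤ k) (hkn : k ≤ n) (lam : k.Partition) (q : ℕ)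
    (φ : koszulTerm n q ⟶ simpleModuleL hk hkn lam) : koszulInclusion n q ≫ φ = 0 := by
  by_cases h : q + 1 = k ∧ lam.parts = Multiset.replicate k 1
  · obtain ⟨rfl, h⟩ := h
    obtain rfl : lam = onesPartition (q + 1) := Nat.Partition.ext h
    rw [← cancel_mono (simpleModuleIso hk hkn).hom, Limits.zero_comp, Category.assoc]
    obtain ⟨a, ha⟩ := koszulTerm_hom_eq_smul hkn (φ ≫ (simpleModuleIso hk hkn).hom)
    rw [ha, Linear.comp_smul, koszulInclusion_comp_projection, smul_zero]
  · rw [koszulTerm_hom_eq_zero hk hkn lam (fun h1 h2 => h ⟨h1, h2⟩) φ, Limits.comp_zero]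

end

theorem propositionp (n k r m : ℕ) (hk : 1 ≤ k) (hkn : k ≤ n) (hr : 1 ≤ r) (hrn : r ≤ n)
    (lam : k.Partition) :
    (lam.parts = Multiset.replicate (r + m) 1 →
      Nonempty (CategoryTheory.Abelian.Ext
        (simpleModuleL hr hrn (onesPartition r)) (simpleModuleL hk hkn lam) m ≃ₗ[ℂ] ℂ)) ∧
    (lam.parts ≠ Multiset.replicate (r + m) 1 →
      Subsingleton (CategoryTheory.Abelian.Ext
        (simpleModuleL hr hrn (onesPartition r)) (simpleModuleL hk hkn lam) m)) := by
  -- The resolution is indexed so that its term `q` is the module of (q+1)-forms; thus L((1^r)) is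
  -- syzygy r − 1, and degree m involves term q + m, the forms of degree r + m.
  obtain ⟨q, rfl⟩ := Nat.exists_eq_add_of_le' hr
  obtain ⟨E⟩ := CategoryTheory.Abelian.Ext.nonempty_linearEquiv_hom_of_resolution (𝕜 := ℂ)
    (koszulInclusion n) (koszulProjection n) (koszulInclusion_comp_projection n)
    (koszul_shortExact n) (simpleModuleL hk hkn lam) (koszulInclusion_comp hk hkn lam) m q
  have E' := (CategoryTheory.Abelian.Ext.congrLeft (𝕜 := ℂ) (simpleModuleIso hr hrn)
    (simpleModuleL hk hkn lam) m).symm.trans E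
  constructor
  · intro h
    have hkq : k = q + m + 1 := by
      have := lam.parts_sum
      rw [h, Multiset.sum_replicate] at this
      simp only [smul_eq_mul, mul_one] at this
      omega
    subst hkq
    obtain rfl : lam = onesPartition (q + m + 1) :=
      Nat.Partition.ext (h.trans (by rw [add_right_comm]; rfl))
    obtain ⟨F⟩ := nonempty_hom_linearEquiv hk hkn
    exact ⟨E'.trans F⟩
  · intro h
    have : Subsingleton (koszulTerm n (q + m) ⟶ simpleModuleL hk hkn lam) :=
      ⟨fun a b => by
        have hz := koszulTerm_hom_eq_zero (q := q + m) hk hkn lam fun h1 h2 =>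
          h (by rw [h2, ← h1, add_right_comm])
        rw [hz a, hz b]⟩
    exact E'.toEquiv.subsingleton
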